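/- Two homeomorphisms $f,g$ of a topological space $X$ are *isotopic* if there is a homotopy $h:[0,1]\times X\to X$ from $f$ to $g$ such that each $h_t$ is a homeomorphism of $X$; the *mapping class group* $\mathrm{MG}(X)$ is the group of all homeomorphisms $X\to X$ modulo isotopy. A *surface* is a connected Hausdorff space in which every point has a neighborhood homeomorphic to $\mathbb R^2$. A space $X$ is of *Type I* if $X=\bigcup_{\alpha<\omega_1}X_\alpha$ with each $X_\alpha$ open, each closure $\overline{X_\alpha}$ Lindelöf, and $\overline{X_\alpha}\subset X_\beta$ whenever $\alpha<\beta<\omega_1$. The *Prüfer surface* $\mathsf P$ (a surface with boundary) is the disjoint union of the open half plane $H_0=\{\langle x,y\rangle\in\mathbb R^2: x>0\}$ and copies $\mathbb R_c$ of $\mathbb R$, one for each $c\in\mathbb R$; points of $H_0$ have their usual neighborhoods, and a neighborhood basis of $u\in\mathbb R_c$ is given by the sets $(a,b)_c\cup\{\langle x,y\rangle\in H_0: ax+c<y<bx+c,\ x<\epsilon\}$ with $a<u<b$ and $\epsilon>0$, where $(a,b)_c$ denotes the copy of the interval $(a,b)$ in $\mathbb R_c$. **Theorem.** Let $\mathfrak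 c=2^{\aleph_0}$. (1) The Prüfer surface $\mathsf P$ is contractible, and $\mathrm{MG}(\mathsf P)$ has cardinality at least $\mathfrak c$. (2) There is a contractible Type I surface $M$ such that $\mathrm{MG}(M)$ has cardinality at least $\mathfrak c$. -/

import Mathlib

/-- Two homeomorphisms `f, g` of `X` are isotopic if there is a homotopy `h` from `f` to `g`
such that `h_t` is a homeomorphism for every `t ∈ [0,1]`. -/
def Isotopic {X : Type*} [TopologicalSpace X] (f g : X ≃ₜ X) : Prop :=
  ∃ h : ContinuousMap.Homotopy (f : C(X, X)) (g : C(X, X)),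
    ∀ t : unitInterval, IsHomeomorph (fun x => h (t, x))

theorem Isotopic.refl {X : Type*} [TopologicalSpace X] (f : X ≃ₜ X) : Isotopic f f :=
  ⟨ContinuousMap.Homotopy.refl _, fun _ => f.isHomeomorph⟩

theorem Isotopic.symm {X : Type*} [TopologicalSpace X] {f g : X ≃ₜ X} (h : Isotopic f g) :
    Isotopic g f := by
  obtain ⟨h, hh⟩ := h
  exact ⟨h.symm, fun t => hh (unitInterval.symm t)⟩

theorem Isotopic.mul {X : Type*} [TopologicalSpace X] {f₁ g₁ f₂ g₂ : X ≃ₜ X}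
    (h₁ : Isotopic f₁ g₁) (h₂ : Isotopic f₂ g₂) : Isotopic (f₁ * f₂) (g₁ * g₂) := by
  obtain ⟨h, hh⟩ := h₁
  obtain ⟨k, hk⟩ := h₂
  refine ⟨⟨⟨fun p => h (p.1, k (p.1, p.2)),
      h.continuous.comp (continuous_fst.prodMk (k.continuous.comp
        (continuous_fst.prodMk continuous_snd)))⟩, fun x => ?_, fun x => ?_⟩, fun t => ?_⟩
  · simp
  · simp
  · exact (hh t).comp (hk t)

/-- The normal subgroup of `Homeo(X)` of all homeomorphisms isotopic to the identity. -/
def isotopicToId (X : Type*) [TopologicalSpace X] : Subgroup (X ≃ₜ X) where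
  carrier := {f | Isotopic f 1}
  one_mem' := Isotopic.refl 1
  mul_mem' := fun {f g} hf hg => by simpa using Isotopic.mul hf hg
  inv_mem' := fun {f} hf => by simpa using (Isotopic.mul (Isotopic.refl f⁻¹) hf).symm

instance isotopicToId_normal (X : Type*) [TopologicalSpace X] : (isotopicToId X).Normal where
  conj_mem := fun f hf g => by
    have h := Isotopic.mul (Isotopic.mul (Isotopic.refl g) hf) (Isotopic.refl g⁻¹)
    rw [mul_one, mul_inv_cancel] at h
    exact h

/-- The mapping class group of `X`: the group of homeomorphisms of `X` modulo isotopy. -/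
abbrev MappingClassGroup (X : Type*) [TopologicalSpace X] : Type _ :=
  (X ≃ₜ X) ⧸ isotopicToId X

/-- Two homeomorphisms define the same mapping class if and only if they are isotopic. -/
theorem mappingClass_eq_iff {X : Type*} [TopologicalSpace X] (f g : X ≃ₜ X) :
    (QuotientGroup.mk f : MappingClassGroup X) = QuotientGroup.mk g ↔ Isotopic f g := by
  rw [QuotientGroup.eq]
  constructor
  · intro h
    have h' := Isotopic.mul (Isotopic.refl f) (show Isotopic (f⁻¹ * g) 1 from h)
    simpa using h'.symm
  · intro h
    have h' := Isotopic.mul (Isotopic.refl f⁻¹) h.symm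
    rw [inv_mul_cancel] at h'
    exact h'

/-- A surface: a connected Hausdorff space in which every point has a neighbourhood
homeomorphic to the Euclidean plane (in particular there is no boundary). -/
structure IsSurface (M : Type*) [TopologicalSpace M] : Prop where
  t2 : T2Space M
  connected : ConnectedSpace M
  locallyEuclidean :
    ∀ x : M, ∃ U ∈ nhds x, Nonempty (U ≃ₜ EuclideanSpace ℝ (Fin 2))

/-- `M` is of Type I: it is the union of open sets `M_α`, `α < ω₁`, with Lindelöf closures, such
that the closure of `M_α` is contained in `M_β` whenever `α < β < ω₁`. -/
def IsTypeI (M : Type*) [TopologicalSpace M] : Prop :=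
  ∃ X : Ordinal.{0} → Set M,
    (∀ α < Ordinal.omega 1, IsOpen (X α) ∧ IsLindelof (closure (X α))) ∧
    (∀ α β, α < β → β < Ordinal.omega 1 → closure (X α) ⊆ X β) ∧
    (∀ x : M, ∃ α < Ordinal.omega 1, x ∈ X α)

/-- The points of the (separable) Prüfer surface: the points `⟨x, y⟩` of the open half plane
`H₀ = {x > 0}`, and for each height `c` the points `u` of a copy `ℝ_c` of the real line, which
replaces the point `⟨0, c⟩`. -/
inductive PruferSurface : Type
  | inner (p : {p : ℝ × ℝ // 0 < p.1}) : PruferSurface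
  | bdry (c u : ℝ) : PruferSurface

namespace PruferSurface

/-- The basic neighbourhood `T^c_{a,b,ε}`: the interval `(a, b)` of `ℝ_c` together with the open
triangle bounded by the lines of slopes `a` and `b` through `⟨0, c⟩` and the vertical line at `ε`. -/
def basicNhd (c a b ε : ℝ) : Set PruferSurface :=
  {q | match q with
    | inner p => a * p.1.1 + c < p.1.2 ∧ p.1.2 < b * p.1.1 + c ∧ p.1.1 < ε
    | bdry c' u => c' = c ∧ a < u ∧ u < b}

theorem basicNhd_mono {c a a' b b' ε ε' : ℝ} (ha : a' ≤ a) (hb : b ≤ b') (hε : ε ≤ ε') :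
    basicNhd c a b ε ⊆ basicNhd c a' b' ε' := by
  rintro (p | ⟨c', u⟩) h
  · obtain ⟨h1, h2, h3⟩ := h
    have := p.2
    exact ⟨by nlinarith, by nlinarith, by linarith⟩
  · obtain ⟨h1, h2, h3⟩ := h
    exact ⟨h1, by linarith, by linarith⟩

/-- The topology of the Prüfer surface: points of the open half plane have their usual
neighbourhoods, and the sets `T^c_{a,b,ε}` with `a < u < b` and `ε > 0` form a neighbourhood basis
at `u ∈ ℝ_c`. -/
instance : TopologicalSpace PruferSurface where
  IsOpen U := IsOpen (inner ⁻¹' U) ∧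
    ∀ c u, bdry c u ∈ U → ∃ a b ε : ℝ, a < u ∧ u < b ∧ 0 < ε ∧ basicNhd c a b ε ⊆ U
  isOpen_univ := ⟨isOpen_univ, fun _ u _ =>
    ⟨u - 1, u + 1, 1, by linarith, by linarith, one_pos, Set.subset_univ _⟩⟩
  isOpen_inter := by
    rintro U V ⟨hU, hU'⟩ ⟨hV, hV'⟩
    refine ⟨hU.inter hV, fun c u hu => ?_⟩
    obtain ⟨a, b, ε, ha, hb, hε, h⟩ := hU' c u hu.1
    obtain ⟨a', b', ε', ha', hb', hε', h'⟩ := hV' c u hu.2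
    exact ⟨max a a', min b b', min ε ε', max_lt ha ha', lt_min hb hb', lt_min hε hε',
      Set.subset_inter
        ((basicNhd_mono (le_max_left _ _) (min_le_left _ _) (min_le_left _ _)).trans h)
        ((basicNhd_mono (le_max_right _ _) (min_le_right _ _) (min_le_right _ _)).trans h')⟩
  isOpen_sUnion := by
    intro S hS
    refine ⟨?_, fun c u hu => ?_⟩
    · rw [Set.preimage_sUnion]
      exact isOpen_biUnion fun U hU => (hS U hU).1
    · obtain ⟨U, hU, huU⟩ := hu
      obtain ⟨a, b, ε, ha, hb, hε, h⟩ := (hS U hU).2 c u huU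
      exact ⟨a, b, ε, ha, hb, hε, h.trans (Set.subset_sUnion_of_mem hU)⟩

end PruferSurface

/-! Both parts detect mapping classes by one obstruction. Let Y be an open Lindelöf set and Z an
uncountable set which meets every Lindelöf set in a countable set. Suppose that a homeomorphism Θ
moves each point of Z to a point that cannot be joined to it off Y. An isotopy from Θ to the
identity then drags every z ∈ Z through Y and, Y being open, has z in Y at some time from a fixed
countable dense set. At each such time only countably many z are in Y, because the preimage of Y is
Lindelöf; so Z would be countable (`Isotopic.countable_of_not_joinedIn`).

In the Prüfer surface, Y is the open half plane. Its complement is the disjoint union of the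
relatively open lines ℝ_c, which the translations along the boundary permute, so different
translations are not isotopic.

For the second part, Prüfer's construction is iterated along a tree (`RoadSurface`). Every node
carries a half plane, drawn as a strip of heights, and the strips above it are attached at its upper
end, each approached along lines of an integer direction. Charts along branches need real heights
that increase along each branch, while Z needs uncountably many nodes and Type I needs countable
levels. An Aronszajn tree of sets of rationals provides all three, heights being sums of summable
weights. Over each of countably many nodes `fst i` stand copies of this tree indexed by ℤ; a
sequence J : ℕ → ℤ shifts the copies over `fst i` by J i (`CopyTree.translate`), and Y is the part
of the surface below the copies together with their lowest strips.

Contractibility has the same reason in both cases. A boundary line cannot simply be pushed inside,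
since the push forgets the position on the line. So all boundary lines are first squeezed to points
simultaneously. After that, the Prüfer surface moves into the half plane, and the tree surface is
pushed down along its branches into the strip of the root, by cutting heights off at a decreasing
bound. -/

open Set Filter Topology unitInterval

/-- If `Θ` is isotopic to the identity and every point of `Z` can only be joined to its image under
`Θ` through the Lindelöf open set `Y`, then `Z` is countable, provided that Lindelöf sets meet
`Z` in countable sets. -/
theorem Isotopic.countable_of_not_joinedIn {X : Type*} [TopologicalSpace X] {Θ : X ≃ₜ X}
    (hΘ : Isotopic Θ 1) {Y Z : Set X} (hYo : IsOpen Y) (hY : IsLindelof Y)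
    (hZ : ∀ L, IsLindelof L → (Z ∩ L).Countable)
    (hsep : ∀ z ∈ Z, ¬ JoinedIn Yᶜ (Θ z) z) : Z.Countable := by
  obtain ⟨h, hh⟩ := hΘ
  obtain ⟨D, hDc, hD⟩ := TopologicalSpace.exists_countable_dense I
  -- A track that never enters Y would join Θ z to z off Y; a track that does enter it is in Y on an
  -- open set of times.
  have key : Z ⊆ ⋃ t ∈ D, Z ∩ (fun x => h (t, x)) ⁻¹' Y := by
    intro z hz
    by_cases hex : ∃ t, h (t, z) ∈ Y
    · have ho : IsOpen ((fun t => h (t, z)) ⁻¹' Y) :=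
        hYo.preimage (h.continuous.comp (by fun_prop))
      obtain ⟨t, htY, htD⟩ := hD.exists_mem_open ho hex
      exact mem_biUnion htY ⟨hz, htD⟩
    · push Not at hex
      refine absurd ⟨⟨⟨fun t => h (t, z), h.continuous.comp (by fun_prop)⟩, ?_, ?_⟩, hex⟩
        (hsep z hz)
      · simp
      · simp
  refine (hDc.biUnion fun t _ => hZ _ ?_).mono key
  -- This is where each stage must be a homeomorphism: the preimage of Y is the image of Y under the
  -- inverse, hence Lindelöf.
  have := hY.image ((hh t).homeomorph).symm.continuous
  rwa [Homeomorph.image_symm] at this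

theorem continuum_le_mk_mappingClassGroup {X : Type} [TopologicalSpace X] {ι : Type}
    (hι : Cardinal.mk ι = Cardinal.continuum) (e : ι → X ≃ₜ X)
    (he : ∀ a b, Isotopic (e a) (e b) → a = b) :
    Cardinal.continuum ≤ Cardinal.mk (MappingClassGroup X) := by
  rw [← hι]
  refine Cardinal.mk_le_of_injective (f := fun a => (QuotientGroup.mk (e a) : MappingClassGroup X))
    fun a b hab => he a b ((mappingClass_eq_iff _ _).1 hab)

theorem not_countable_of_mk_eq_continuum {α : Type} (h : Cardinal.mk α = Cardinal.continuum) :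
    ¬ (univ : Set α).Countable := by
  intro hc
  have := Cardinal.le_aleph0_iff_set_countable.2 hc
  rw [Cardinal.mk_univ, h] at this
  exact absurd this (not_le.2 Cardinal.aleph0_lt_continuum)

/-! ### The Prüfer surface: topology and slope coordinates -/

namespace PruferSurface

theorem isOpen_iff {U : Set PruferSurface} : IsOpen U ↔ IsOpen (inner ⁻¹' U) ∧
    ∀ c u, bdry c u ∈ U → ∃ a b ε : ℝ, a < u ∧ u < b ∧ 0 < ε ∧ basicNhd c a b ε ⊆ U := Iff.rfl

theorem inner_injective : Function.Injective inner := fun _ _ h => by cases h; rfl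

theorem continuous_inner : Continuous inner := ⟨fun _ hU => (isOpen_iff.1 hU).1⟩

theorem isOpenMap_inner : IsOpenMap inner := by
  intro V hV
  refine isOpen_iff.2 ⟨?_, ?_⟩
  · rwa [preimage_image_eq _ inner_injective]
  · rintro c u ⟨p, -, hp⟩
    cases hp

theorem isOpenEmbedding_inner : IsOpenEmbedding inner :=
  .of_continuous_injective_isOpenMap continuous_inner inner_injective isOpenMap_inner

theorem isOpen_basicNhd {c a b ε : ℝ} (hε : 0 < ε) : IsOpen (basicNhd c a b ε) := by
  refine isOpen_iff.2 ⟨?_, ?_⟩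
  · have : inner ⁻¹' basicNhd c a b ε = {p : {p : ℝ × ℝ // 0 < p.1} |
        a * p.1.1 + c < p.1.2 ∧ p.1.2 < b * p.1.1 + c ∧ p.1.1 < ε} := rfl
    rw [this]
    simp only [ofPred_and]
    exact (isOpen_lt (by fun_prop) (by fun_prop)).inter
      ((isOpen_lt (by fun_prop) (by fun_prop)).inter (isOpen_lt (by fun_prop) (by fun_prop)))
  · rintro c' u ⟨rfl, h1, h2⟩
    exact ⟨a, b, ε, h1, h2, hε, Subset.rfl⟩

/-- The slope coordinates `(x, u) ↦ ⟨x, c + u x⟩` near the boundary line `ℝ_c`. -/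
noncomputable def chart (c : ℝ) (p : ℝ × ℝ) : PruferSurface :=
  if h : 0 < p.1 then inner ⟨(p.1, c + p.2 * p.1), h⟩ else bdry c p.2

theorem chart_of_pos {c : ℝ} {p : ℝ × ℝ} (h : 0 < p.1) :
    chart c p = inner ⟨(p.1, c + p.2 * p.1), h⟩ := dif_pos h

theorem chart_of_nonpos {c : ℝ} {p : ℝ × ℝ} (h : p.1 ≤ 0) : chart c p = bdry c p.2 :=
  dif_neg (not_lt.2 h)

/-- Reduces continuity at a boundary point to continuity in slope coordinates. The triangle of
slopes u ± ε and width ε is covered by the image of the ε-ball in the sup metric. Since the chart is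
independent of x for x ≤ 0, the whole plane serves as its domain. -/
theorem nhds_bdry_le (c u : ℝ) : 𝓝 (bdry c u) ≤ map (chart c) (𝓝 (0, u)) := by
  intro S hS
  obtain ⟨ε, hε, h⟩ := Metric.mem_nhds_iff.1 (mem_map.1 hS)
  refine mem_of_superset ((isOpen_basicNhd hε).mem_nhds
    (show bdry c u ∈ basicNhd c (u - ε) (u + ε) ε from ⟨rfl, by linarith, by linarith⟩)) ?_
  rintro (⟨⟨x, y⟩, hx⟩ | ⟨c', v⟩)
  · rintro ⟨h1, h2, h3⟩
    simp only at h1 h2 h3 hx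
    have hm : ((x, (y - c) / x) : ℝ × ℝ) ∈ Metric.ball ((0 : ℝ), u) ε := by
      rw [Metric.mem_ball, Prod.dist_eq, max_lt_iff]
      constructor
      · simpa [abs_of_pos hx] using h3
      · have h4 : u - ε < (y - c) / x := by rw [lt_div_iff₀ hx]; linarith
        have h5 : (y - c) / x < u + ε := by rw [div_lt_iff₀ hx]; linarith
        simp only [Real.dist_eq, abs_lt]
        constructor <;> linarith
    have := h hm
    rw [mem_preimage, chart_of_pos (by exact hx)] at this
    convert this using 4
    field_simp
    ring
  · rintro ⟨rfl, h2, h3⟩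
    have hm : ((0, v) : ℝ × ℝ) ∈ Metric.ball ((0 : ℝ), u) ε := by
      rw [Metric.mem_ball, Prod.dist_eq, max_lt_iff]
      refine ⟨by simpa using hε, ?_⟩
      simp only [Real.dist_eq, abs_lt]
      constructor <;> linarith
    have := h hm
    rwa [mem_preimage, chart_of_nonpos (by simp)] at this

theorem continuous_chart (c : ℝ) : Continuous (chart c) := by
  refine ⟨fun U hU => isOpen_iff_mem_nhds.2 ?_⟩
  rintro ⟨x, u⟩ hp
  obtain ⟨hU1, hU2⟩ := isOpen_iff.1 hU
  rcases lt_or_ge 0 x with hx | hx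
  · have h1 : ContinuousOn (fun p : ℝ × ℝ => chart c p) {p | 0 < p.1} := by
      rw [continuousOn_iff_continuous_domRestrict]
      have : ({p : ℝ × ℝ | 0 < p.1}.domRestrict fun p => chart c p) =
          fun p => inner ⟨(p.1.1, c + p.1.2 * p.1.1), p.2⟩ := by
        ext p
        exact chart_of_pos p.2
      rw [this]
      exact continuous_inner.comp (by fun_prop)
    have h2 := h1.continuousAt ((isOpen_lt continuous_const continuous_fst).mem_nhds
      (show ((x, u) : ℝ × ℝ) ∈ {p : ℝ × ℝ | 0 < p.1} from hx))
    exact h2 (hU.mem_nhds hp)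
  · have hp' : bdry c u ∈ U := by
      have := hp
      rwa [mem_preimage, chart_of_nonpos hx] at this
    obtain ⟨a, b, ε, ha, hb, hε, h⟩ := hU2 c u hp'
    have : {p : ℝ × ℝ | a < p.2 ∧ p.2 < b ∧ p.1 < ε} ∈ 𝓝 (x, u) := by
      refine IsOpen.mem_nhds ?_ ⟨ha, hb, by simp only; linarith⟩
      simp only [ofPred_and]
      exact (isOpen_lt (by fun_prop) (by fun_prop)).inter
        ((isOpen_lt (by fun_prop) (by fun_prop)).inter (isOpen_lt (by fun_prop) (by fun_prop)))
    refine mem_of_superset this ?_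
    rintro ⟨x', u'⟩ ⟨h1, h2, h3⟩
    simp only at h1 h2 h3
    apply h
    rcases lt_or_ge 0 x' with hx' | hx'
    · rw [chart_of_pos (by exact hx')]
      refine ⟨?_, ?_, h3⟩ <;> simp only <;> nlinarith
    · rw [chart_of_nonpos (by exact hx')]
      exact ⟨rfl, h1, h2⟩

/-- A map is continuous as soon as it is so on the half plane and in slope coordinates. -/
theorem continuous_of_chart {Y Z : Type*} [TopologicalSpace Y] [TopologicalSpace Z]
    {f : Y × PruferSurface → Z}
    (h₁ : Continuous fun q : Y × {p : ℝ × ℝ // 0 < p.1} => f (q.1, inner q.2))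
    (h₂ : ∀ c y u, ContinuousAt (fun q : Y × (ℝ × ℝ) => f (q.1, chart c q.2)) (y, (0, u))) :
    Continuous f := by
  rw [continuous_iff_continuousAt]
  rintro ⟨y, p | ⟨c, u⟩⟩
  · have := h₁.continuousAt (x := (y, p))
    unfold ContinuousAt at this ⊢
    rw [nhds_prod_eq, ← isOpenEmbedding_inner.map_nhds_eq, ← Filter.map_id (f := 𝓝 y),
      Filter.prod_map_map_eq, ← nhds_prod_eq, tendsto_map'_iff]
    exact this
  · have := h₂ c y u
    unfold ContinuousAt at this ⊢
    simp only [chart_of_nonpos (c := c) (p := (0, u)) le_rfl] at this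
    rw [nhds_prod_eq]
    refine Tendsto.mono_left ?_ (Filter.prod_mono_right _ (nhds_bdry_le c u))
    rw [← Filter.map_id (f := 𝓝 y), Filter.prod_map_map_eq, ← nhds_prod_eq, tendsto_map'_iff]
    exact this

/-! ### Contractibility of the Prüfer surface -/

/-- The homotopy which squeezes every boundary line to a point: it fixes the height `y` and
increases the distance to the boundary from `x` to `√x`. -/
noncomputable def squeeze : I × PruferSurface → PruferSurface
  | (t, inner p) => inner ⟨(p.1.1 / (t + (1 - t) * √p.1.1), p.1.2), by
      have := Real.sqrt_pos.2 p.2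
      have h0 := t.2.1
      have h1 := t.2.2
      refine div_pos p.2 ?_
      rcases h0.eq_or_lt with h | h
      · rw [← h]; simpa using this
      · nlinarith⟩
  | (t, bdry c u) => bdry c (t * u)

theorem squeeze_denominator_pos (t : I) {x : ℝ} (hx : 0 < x) :
    0 < (t : ℝ) + (1 - t) * √x := by
  have := Real.sqrt_pos.2 hx
  have h0 := t.2.1
  have h1 := t.2.2
  rcases h0.eq_or_lt with h | h
  · rw [← h]; simpa using this
  · nlinarith

/-- As y is fixed, dividing x by a number multiplies the slope by it. For x ≤ 0 the root is 0 and
the multiplier is t, as on the boundary. -/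
theorem squeeze_chart (c : ℝ) (t : I) (x u : ℝ) :
    squeeze (t, chart c (x, u)) =
      chart c (max x 0 / (t + (1 - t) * √x), u * (t + (1 - t) * √x)) := by
  rcases lt_or_ge 0 x with hx | hx
  · have hd := squeeze_denominator_pos t hx
    rw [chart_of_pos (by exact hx), max_eq_left hx.le,
      chart_of_pos (by simpa using div_pos hx hd)]
    simp only [squeeze, inner.injEq, Subtype.mk.injEq, Prod.mk.injEq, true_and]
    field_simp
  · rw [chart_of_nonpos (by exact hx), chart_of_nonpos (by simp [max_eq_right hx])]
    simp [squeeze, Real.sqrt_eq_zero_of_nonpos hx, mul_comm]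

theorem continuous_squeeze : Continuous squeeze := by
  refine continuous_of_chart ?_ ?_
  · refine continuous_inner.comp (Continuous.subtype_mk ?_ _)
    refine Continuous.prodMk (Continuous.div (by fun_prop) (by fun_prop) fun q => ?_) (by fun_prop)
    exact (squeeze_denominator_pos q.1 q.2.2).ne'
  · intro c t u
    simp only [fun q : I × (ℝ × ℝ) => squeeze_chart c q.1 q.2.1 q.2.2]
    refine (continuous_chart c).continuousAt.comp (ContinuousAt.prodMk ?_ (by fun_prop))
    unfold ContinuousAt
    simp only [max_self, zero_div]
    have h0 : Tendsto (fun q : I × (ℝ × ℝ) => √q.2.1) (𝓝 (t, (0, u))) (𝓝 0) := by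
      have : ContinuousAt (fun q : I × (ℝ × ℝ) => √q.2.1) (t, (0, u)) := by fun_prop
      simpa [ContinuousAt] using this
    -- For x < 1 the denominator is at least √x, so the new distance is at most √x, uniformly in t.
    have hev : ∀ᶠ q : I × (ℝ × ℝ) in 𝓝 (t, (0, u)), q.2.1 < 1 :=
      (isOpen_lt (by fun_prop) (by fun_prop)).mem_nhds (by simp)
    refine squeeze_zero' (Eventually.of_forall fun q => ?_) (hev.mono fun q hq => ?_) h0
    · have h0 := q.1.2.1
      have h1 := q.1.2.2
      have := Real.sqrt_nonneg q.2.1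
      refine div_nonneg (le_max_right _ _) ?_
      nlinarith
    · rcases lt_or_ge 0 q.2.1 with hx | hx
      · rw [max_eq_left hx.le, div_le_iff₀ (squeeze_denominator_pos q.1 hx)]
        have h3 := Real.sq_sqrt hx.le
        have h4 := Real.sqrt_pos.2 hx
        have h5 : √q.2.1 ≤ 1 := Real.sqrt_le_one.2 hq.le
        have h0 := q.1.2.1
        nlinarith [mul_nonneg (mul_nonneg h0 h4.le) (sub_nonneg.2 h5)]
      · simp [max_eq_right hx]

/-- The homotopy which moves the squeezed surface into the half plane. -/
noncomputable def push : I × PruferSurface → PruferSurface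
  | (t, inner p) => inner ⟨(√p.1.1 + t, p.1.2), by
      have := Real.sqrt_pos.2 p.2
      have h0 := t.2.1
      show 0 < √p.1.1 + t
      linarith⟩
  | (t, bdry c _) => chart c (t, 0)

/-- The slope is multiplied by x / (√x + t) ≤ √x, which vanishes at the boundary even as t tends to
0. This is why the push starts from √x and not from x. -/
theorem push_chart (c : ℝ) (t : I) (x u : ℝ) :
    push (t, chart c (x, u)) = chart c (√x + t, u * (max x 0 / (√x + t))) := by
  have h0 := t.2.1
  rcases lt_or_ge 0 x with hx | hx
  · have hd : 0 < √x + t := by have := Real.sqrt_pos.2 hx; linarith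
    rw [chart_of_pos (by exact hx), max_eq_left hx.le, chart_of_pos (by exact hd)]
    simp only [push, inner.injEq, Subtype.mk.injEq, Prod.mk.injEq, true_and]
    field_simp
  · rw [chart_of_nonpos (by exact hx)]
    simp [push, Real.sqrt_eq_zero_of_nonpos hx, max_eq_right hx]

theorem continuous_push : Continuous push := by
  refine continuous_of_chart ?_ ?_
  · exact continuous_inner.comp (Continuous.subtype_mk (by fun_prop) _)
  · intro c t u
    simp only [fun q : I × (ℝ × ℝ) => push_chart c q.1 q.2.1 q.2.2]
    refine (continuous_chart c).continuousAt.comp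
      (ContinuousAt.prodMk (by fun_prop) (ContinuousAt.mul (by fun_prop) ?_))
    unfold ContinuousAt
    simp only [max_self, zero_div]
    have h0 : Tendsto (fun q : I × (ℝ × ℝ) => √q.2.1) (𝓝 (t, (0, u))) (𝓝 0) := by
      have : ContinuousAt (fun q : I × (ℝ × ℝ) => √q.2.1) (t, (0, u)) := by fun_prop
      simpa [ContinuousAt] using this
    refine squeeze_zero (fun q => ?_) (fun q => ?_) h0
    · exact div_nonneg (le_max_right _ _) (add_nonneg (Real.sqrt_nonneg _) q.1.2.1)
    · rcases lt_or_ge 0 q.2.1 with hx | hx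
      · have h4 := Real.sqrt_pos.2 hx
        have h0 := q.1.2.1
        rw [max_eq_left hx.le, div_le_iff₀ (by linarith)]
        have h3 := Real.sq_sqrt hx.le
        nlinarith
      · simp [max_eq_right hx]

theorem contractibleSpace : ContractibleSpace PruferSurface := by
  rw [contractible_iff_id_nullhomotopic]
  let squeezed : C(PruferSurface, PruferSurface) :=
    ⟨fun z => squeeze (0, z), continuous_squeeze.comp (by fun_prop)⟩
  let pushed : C(PruferSurface, PruferSurface) :=
    ⟨fun z => push (1, z), continuous_push.comp (by fun_prop)⟩
  have h1 : (ContinuousMap.id PruferSurface).Homotopic squeezed :=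
    ContinuousMap.Homotopic.symm ⟨⟨⟨squeeze, continuous_squeeze⟩, fun _ => rfl, fun z => by
      rcases z with p | ⟨c, u⟩ <;> simp [squeeze]⟩⟩
  have h2 : squeezed.Homotopic pushed :=
    ⟨⟨⟨push, continuous_push⟩, fun z => by
      rcases z with p | ⟨c, u⟩
      · simp only [push, squeezed, ContinuousMap.coe_mk, squeeze, inner.injEq, Subtype.mk.injEq,
          Prod.mk.injEq, and_true]
        have := Real.sqrt_pos.2 p.2
        have h3 := Real.sq_sqrt p.2.le
        simp only [Icc.coe_zero, sub_zero, one_mul, zero_add, add_zero]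
        field_simp
        exact h3
      · simp [push, squeezed, squeeze, chart_of_nonpos], fun _ => rfl⟩⟩
  have : ContractibleSpace {p : ℝ × ℝ // 0 < p.1} := by
    have hc : Convex ℝ {p : ℝ × ℝ | 0 < p.1} := by
      have := (convex_Ioi (0 : ℝ)).linear_preimage (LinearMap.fst ℝ ℝ ℝ)
      exact this
    exact hc.contractibleSpace ⟨(1, 0), show (0 : ℝ) < 1 from one_pos⟩
  have hmem : ∀ z, ∃ p, push (1, z) = inner p := by
    rintro (p | ⟨c, u⟩)
    · exact ⟨_, rfl⟩
    · exact ⟨_, chart_of_pos (by simp)⟩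
  choose g hg using hmem
  have hgc : Continuous g := by
    rw [isOpenEmbedding_inner.isInducing.continuous_iff]
    have : inner ∘ g = pushed := by ext z; exact (hg z).symm
    rw [this]
    exact pushed.continuous
  have h3 : pushed.Nullhomotopic := by
    have h4 : pushed = ((⟨inner, continuous_inner⟩ : C(_, _)).comp (ContinuousMap.id _)).comp
        ⟨g, hgc⟩ := by
      ext z
      exact hg z
    rw [h4]
    exact ((id_nullhomotopic _).comp_right _).comp_left _
  obtain ⟨z, hz⟩ := h3
  exact ⟨z, (h1.trans h2).trans hz⟩

/-! ### Translations and mapping classes of the Prüfer surface -/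

/-- The translation of the Prüfer surface by `s` in the direction of its boundary. -/
def shiftFun (s : ℝ) : PruferSurface → PruferSurface
  | inner p => inner ⟨(p.1.1, p.1.2 + s), p.2⟩
  | bdry c u => bdry (c + s) u

theorem continuous_shiftFun (s : ℝ) : Continuous (shiftFun s) := by
  have : Continuous fun q : Unit × PruferSurface => shiftFun s q.2 := by
    refine continuous_of_chart ?_ ?_
    · exact continuous_inner.comp (Continuous.subtype_mk (by fun_prop) _)
    · intro c y u
      have h : (fun q : Unit × (ℝ × ℝ) => shiftFun s (chart c q.2)) =
          fun q => chart (c + s) q.2 := by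
        ext ⟨-, x, u⟩
        rcases lt_or_ge 0 x with hx | hx
        · simp only [chart_of_pos (p := (x, u)) hx, shiftFun, inner.injEq, Subtype.mk.injEq,
            Prod.mk.injEq, true_and]
          ring
        · simp [chart_of_nonpos (p := (x, u)) hx, shiftFun]
      simp only [h]
      exact ((continuous_chart _).comp continuous_snd).continuousAt
  exact this.comp (by fun_prop : Continuous fun z : PruferSurface => ((), z))

def shift (s : ℝ) : PruferSurface ≃ₜ PruferSurface where
  toFun := shiftFun s
  invFun := shiftFun (-s)
  left_inv z := by rcases z with p | ⟨c, u⟩ <;> simp [shiftFun]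
  right_inv z := by rcases z with p | ⟨c, u⟩ <;> simp [shiftFun]
  continuous_toFun := continuous_shiftFun s
  continuous_invFun := continuous_shiftFun (-s)

theorem isOpen_range_inner : IsOpen (range inner) := isOpenEmbedding_inner.isOpen_range

theorem isLindelof_range_inner : IsLindelof (range inner) := by
  rw [← image_univ]
  exact isLindelof_univ.image continuous_inner

theorem isOpen_range_inner_union_range_bdry (c : ℝ) :
    IsOpen (range inner ∪ range (bdry c)) := by
  refine isOpen_iff.2 ⟨?_, ?_⟩
  · convert isOpen_univ
    ext p
    simp
  · intro c' u hu
    have hc : c' = c := by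
      rcases hu with ⟨p, hp⟩ | ⟨v, hv⟩
      · cases hp
      · cases hv; rfl
    subst hc
    refine ⟨u - 1, u + 1, 1, by linarith, by linarith, one_pos, ?_⟩
    rintro (p | ⟨c, v⟩) hq
    · exact Or.inl ⟨p, rfl⟩
    · obtain ⟨rfl, -, -⟩ := hq
      exact Or.inr ⟨v, rfl⟩

/-- The half plane together with one line ℝ_c is open and contains exactly one of the points `bdry c
0`; countably many such sets cover L. -/
theorem countable_inter_of_isLindelof {L : Set PruferSurface} (hL : IsLindelof L) :
    (range (fun c => bdry c 0) ∩ L).Countable := by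
  obtain ⟨K, hK, h⟩ := hL.elim_countable_subcover _ isOpen_range_inner_union_range_bdry
    (fun z _ => by
      rcases z with p | ⟨c, u⟩
      · exact mem_iUnion.2 ⟨0, Or.inl ⟨p, rfl⟩⟩
      · exact mem_iUnion.2 ⟨c, Or.inr ⟨u, rfl⟩⟩)
  refine (hK.image fun c => bdry c 0).mono ?_
  rintro _ ⟨⟨c, rfl⟩, hz⟩
  obtain ⟨c', hc', ⟨p, hp⟩ | ⟨v, hv⟩⟩ := mem_iUnion₂.1 (h hz)
  · cases hp
  · cases hv
    exact ⟨c, hc', rfl⟩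

/-- Off the half plane, ℝ_c and the union of all other lines are disjoint relatively open sets, so
no path passes from one to the other. -/
theorem not_joinedIn_bdry {c c' u u' : ℝ} (hc : c' ≠ c) :
    ¬ JoinedIn (range inner)ᶜ (bdry c' u') (bdry c u) := by
  rintro ⟨γ, hγ⟩
  have hpre := (isPreconnected_univ (α := I)).image γ γ.continuous.continuousOn
  have ho : IsOpen (⋃ d ∈ {d | d ≠ c}, range inner ∪ range (bdry d)) :=
    isOpen_biUnion fun d _ => isOpen_range_inner_union_range_bdry d
  obtain ⟨z, ⟨t, -, rfl⟩, hz1, hz2⟩ := hpre _ _ (isOpen_range_inner_union_range_bdry c) ho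
    (by
      rintro _ ⟨t, -, rfl⟩
      have := hγ t
      rcases hz : γ t with p | ⟨d, v⟩
      · exact absurd ⟨p, hz.symm⟩ this
      · by_cases hd : d = c
        · subst hd
          exact Or.inl (Or.inr ⟨v, rfl⟩)
        · exact Or.inr (mem_biUnion hd (Or.inr ⟨v, rfl⟩)))
    ⟨bdry c u, ⟨1, trivial, γ.target⟩, Or.inr ⟨u, rfl⟩⟩
    ⟨bdry c' u', ⟨0, trivial, γ.source⟩, mem_biUnion (show c' ∈ {d | d ≠ c} from hc)
      (Or.inr ⟨u', rfl⟩)⟩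
  have hzt := hγ t
  obtain ⟨v, hv⟩ := hz1.resolve_left hzt
  obtain ⟨d, hd, h⟩ := mem_iUnion₂.1 hz2
  obtain ⟨v', hv'⟩ := h.resolve_left hzt
  rw [← hv] at hv'
  cases hv'
  exact hd rfl

theorem continuum_le_mk_mappingClassGroup :
    Cardinal.continuum ≤ Cardinal.mk (MappingClassGroup PruferSurface) := by
  refine _root_.continuum_le_mk_mappingClassGroup Cardinal.mk_real shift fun a b hab => ?_
  by_contra hne
  have h := Isotopic.mul (Isotopic.refl (shift b)⁻¹) hab
  rw [inv_mul_cancel] at h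
  -- The composite is the translation by a - b ≠ 0, so it moves every line ℝ_c to a different one.
  have hcount := h.countable_of_not_joinedIn isOpen_range_inner isLindelof_range_inner
    (fun L => countable_inter_of_isLindelof) (by
      rintro _ ⟨c, rfl⟩
      have : ((shift b)⁻¹ * shift a) (bdry c 0) = bdry (c + a + -b) 0 := rfl
      rw [this]
      refine not_joinedIn_bdry fun h => hne ?_
      linarith)
  have hinj : Function.Injective fun c => bdry c 0 := fun c d h => by cases h; rfl
  rw [← image_univ] at hcount
  exact not_countable_of_mk_eq_continuum Cardinal.mk_real
    (countable_of_injective_of_countable_image hinj.injOn hcount)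

end PruferSurface

/-! ### Road trees, heights and slopes -/

/-- A tree whose nodes `k` carry half-open intervals `[ht k, ht k + len k)` of heights, such that
the intervals of the nodes below any node tile an interval, together with integers `dir j h` which
distinguish the directions in which the tree branches above `j`. -/
class RoadTree (N : Type) [PartialOrder N] [OrderBot N] where
  ht : N → ℝ
  len : N → ℝ
  dir : N → N → ℤ
  le_or_le : ∀ {j k h : N}, j ≤ h → k ≤ h → j ≤ k ∨ k ≤ j
  len_pos : ∀ k, 0 < len k
  len_le_one : ∀ k, len k ≤ 1
  ht_bot : ht ⊥ = 0
  ht_add_len_le : ∀ {j k : N}, j < k → ht j + len j ≤ ht k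
  exists_bound : ∃ b, ∀ k, ht k + len k ≤ b
  exists_lt_tile : ∀ {h : N} {x : ℝ}, 0 ≤ x → x < ht h → ∃ k < h, ht k ≤ x ∧ x < ht k + len k
  dir_self : ∀ h, dir h h = 0
  dir_eq : ∀ {j i h : N}, j < i → i ≤ h → dir j h = dir j i
  exists_dir_ne : ∀ {h h' : N}, ¬ h ≤ h' → ¬ h' ≤ h → ∃ j, j < h ∧ j < h' ∧ dir j h ≠ dir j h'

namespace RoadTree

variable {N : Type} [PartialOrder N] [OrderBot N] [RoadTree N]

/-- The supremum of the heights of a node. -/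
def top (k : N) : ℝ := ht k + len k

theorem ht_lt_top (k : N) : ht k < top k := lt_add_of_pos_right _ (len_pos k)

theorem top_le_ht {j k : N} (h : j < k) : top j ≤ ht k := ht_add_len_le h

theorem ht_lt_ht {j k : N} (h : j < k) : ht j < ht k := (ht_lt_top j).trans_le (top_le_ht h)

theorem ht_mono {j k : N} (h : j ≤ k) : ht j ≤ ht k := by
  rcases h.eq_or_lt with rfl | h
  · exact le_rfl
  · exact (ht_lt_ht h).le

theorem top_mono {j k : N} (h : j ≤ k) : top j ≤ top k := by
  rcases h.eq_or_lt with rfl | h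
  · exact le_rfl
  · exact (top_le_ht h).trans (ht_lt_top k).le

theorem ht_nonneg (k : N) : 0 ≤ ht k := by
  rw [← ht_bot (N := N)]
  exact ht_mono bot_le

theorem top_pos (k : N) : 0 < top k := (ht_nonneg k).trans_lt (ht_lt_top k)

/-- Nodes below a common node are comparable and their tiles are disjoint and increasing, so heights
decide the order. -/
theorem le_of_ht_le {i j h : N} (hi : i ≤ h) (hj : j ≤ h) {x : ℝ} (h₁ : ht i ≤ x)
    (h₂ : x < top j) : i ≤ j := by
  rcases le_or_le hi hj with hij | hij
  · exact hij
  rcases hij.eq_or_lt with rfl | hij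
  · exact le_rfl
  · linarith [top_le_ht hij]

theorem exists_tile (h : N) {x : ℝ} (h₀ : 0 ≤ x) (h₁ : x < top h) :
    ∃ k ≤ h, ht k ≤ x ∧ x < top k := by
  rcases lt_or_ge x (ht h) with hx | hx
  · obtain ⟨k, hk, h2⟩ := exists_lt_tile h₀ hx
    exact ⟨k, hk.le, h2⟩
  · exact ⟨h, le_rfl, hx, h₁⟩

open Classical in
/-- The node below `h` at height `x`. -/
noncomputable def nodeAt (h : N) (x : ℝ) : N :=
  if hx : ∃ k ≤ h, ht k ≤ x ∧ x < top k then hx.choose else h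

theorem nodeAt_spec (h : N) {x : ℝ} (h₀ : 0 ≤ x) (h₁ : x < top h) :
    nodeAt h x ≤ h ∧ ht (nodeAt h x) ≤ x ∧ x < top (nodeAt h x) := by
  have hx := exists_tile h h₀ h₁
  rw [nodeAt, dif_pos hx]
  exact hx.choose_spec

theorem nodeAt_eq {h k : N} (hk : k ≤ h) {x : ℝ} (h₁ : ht k ≤ x) (h₂ : x < top k) :
    nodeAt h x = k := by
  obtain ⟨h3, h4, h5⟩ := nodeAt_spec h ((ht_nonneg k).trans h₁) (h₂.trans_le (top_mono hk))
  exact le_antisymm (le_of_ht_le h3 hk h4 h₂) (le_of_ht_le hk h3 h₁ h5)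

/-- The slope coordinate, a parametrization of the heights of `k` by `[0, ∞)`, extended by `0` to
all smaller heights. -/
noncomputable def slope (k : N) (x : ℝ) : ℝ := max (x - ht k) 0 / (top k - x)

theorem slope_of_le {k : N} {x : ℝ} (h : x ≤ ht k) : slope k x = 0 := by
  rw [slope, max_eq_right (by linarith), zero_div]

theorem slope_of_ge {k : N} {x : ℝ} (h : ht k ≤ x) : slope k x = (x - ht k) / (top k - x) := by
  rw [slope, max_eq_left (by linarith)]

theorem slope_nonneg {k : N} {x : ℝ} (h : x < top k) : 0 ≤ slope k x :=
  div_nonneg (le_max_right _ _) (by linarith)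

theorem slope_pos {k : N} {x : ℝ} (h₁ : ht k < x) (h₂ : x < top k) : 0 < slope k x := by
  rw [slope_of_ge h₁.le]
  exact div_pos (by linarith) (by linarith)

theorem slope_mono {k : N} {x y : ℝ} (h : x ≤ y) (hy : y < top k) : slope k x ≤ slope k y := by
  refine div_le_div₀ (le_max_right _ _) (max_le_max_right _ (by linarith)) (by linarith)
    (by linarith)

theorem continuousOn_slope (k : N) : ContinuousOn (slope k) (Iio (top k)) :=
  ContinuousOn.div (by fun_prop) (by fun_prop) fun x hx => by
    have : x < top k := hx
    linarith

/-- Two nodes branch at a third one, up to which the two branches agree. -/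
theorem exists_meet (h h' : N) : ∃ (j : N) (C : ℝ), ∀ x, 0 < x → x < top h →
    (nodeAt h x ≤ h' ↔ x < top j) ∧ (x < top j →
      ((dir (nodeAt h x) h : ℝ) - dir (nodeAt h x) h') * slope (nodeAt h x) x =
        C * slope j x) := by
  have key : ∀ j, j ≤ h → j ≤ h' → (∀ k, k ≤ h → k ≤ h' → k ≤ j) →
      ∀ x, 0 < x → x < top h → (nodeAt h x ≤ h' ↔ x < top j) ∧ (x < top j →
      ((dir (nodeAt h x) h : ℝ) - dir (nodeAt h x) h') * slope (nodeAt h x) x =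
        ((dir j h : ℝ) - dir j h') * slope j x) := by
    intro j hj hj' hmax x hx0 hx1
    obtain ⟨h1, h2, h3⟩ := nodeAt_spec h hx0.le hx1
    have hlt : x < top j → nodeAt h x ≤ j := fun hx => le_of_ht_le h1 hj h2 hx
    refine ⟨⟨fun hk => h3.trans_le (top_mono (hmax _ h1 hk)), fun hx => (hlt hx).trans hj'⟩,
      fun hx => ?_⟩
    rcases (hlt hx).eq_or_lt with he | hl
    · rw [he]
    -- Strictly below j both branches have the same direction, and there `slope j` is 0.
    · rw [dir_eq hl hj, dir_eq hl hj', sub_self, zero_mul,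
        slope_of_le (h3.le.trans (top_le_ht hl)), mul_zero]
  by_cases h1 : h ≤ h'
  · exact ⟨h, _, key h le_rfl h1 fun k hk _ => hk⟩
  by_cases h2 : h' ≤ h
  · exact ⟨h', _, key h' h2 le_rfl fun k _ hk => hk⟩
  obtain ⟨j, hj, hj', hne⟩ := exists_dir_ne h1 h2
  -- A common lower bound strictly above j would force the two directions at j to agree.
  refine ⟨j, _, key j hj.le hj'.le fun k hk hk' => ?_⟩
  rcases le_or_le hj.le hk with hjk | hjk
  · rcases hjk.eq_or_lt with rfl | hjk
    · exact le_rfl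
    · exact absurd ((dir_eq hjk hk).trans (dir_eq hjk hk').symm) hne
  · exact hjk

end RoadTree

/-! ### The surface over a road tree -/

open RoadTree

/-- The points of the surface over a road tree: a copy `{k} × [ht k, ht k + len k) × ℝ` of a half
plane for every node `k`, without the boundary line of the root. -/
@[ext]
structure RoadSurface (N : Type) [PartialOrder N] [OrderBot N] [RoadTree N] where
  node : N
  x : ℝ
  w : ℝ
  x_pos : 0 < x
  ht_le : ht node ≤ x
  lt_top : x < top node

namespace RoadSurface

variable {N : Type} [PartialOrder N] [OrderBot N] [RoadTree N]

open Classical in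
/-- The inverse of the chart along the branch of `h`: in the half plane of `k < h`, the lines
`u = const` are parallel to the direction `dir k h`. -/
noncomputable def chartInv (h : N) (p : ℝ × ℝ) : RoadSurface N :=
  if hp : 0 < p.1 ∧ p.1 < top h then
    ⟨nodeAt h p.1, p.1, p.2 + dir (nodeAt h p.1) h * slope (nodeAt h p.1) p.1, hp.1,
      (nodeAt_spec h hp.1.le hp.2).2.1, (nodeAt_spec h hp.1.le hp.2).2.2⟩
  else ⟨⊥, top (⊥ : N) / 2, 0, half_pos (top_pos _), by
    rw [ht_bot]; exact (half_pos (top_pos _)).le, half_lt_self (top_pos _)⟩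

theorem chartInv_node {h : N} {p : ℝ × ℝ} (h₀ : 0 < p.1) (h₁ : p.1 < top h) :
    (chartInv h p).node = nodeAt h p.1 := by rw [chartInv, dif_pos ⟨h₀, h₁⟩]

theorem chartInv_x {h : N} {p : ℝ × ℝ} (h₀ : 0 < p.1) (h₁ : p.1 < top h) :
    (chartInv h p).x = p.1 := by rw [chartInv, dif_pos ⟨h₀, h₁⟩]

theorem chartInv_w {h : N} {p : ℝ × ℝ} (h₀ : 0 < p.1) (h₁ : p.1 < top h) :
    (chartInv h p).w = p.2 + dir (nodeAt h p.1) h * slope (nodeAt h p.1) p.1 := by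
  rw [chartInv, dif_pos ⟨h₀, h₁⟩]

/-- The chart along the branch of `h`. -/
noncomputable def chart (h : N) : PartialEquiv (RoadSurface N) (ℝ × ℝ) where
  toFun z := (z.x, z.w - dir z.node h * slope z.node z.x)
  invFun := chartInv h
  source := {z | z.node ≤ h}
  target := Ioo 0 (top h) ×ˢ univ
  map_source' z hz := ⟨⟨z.x_pos, z.lt_top.trans_le (top_mono hz)⟩, trivial⟩
  map_target' p hp := by
    rw [mem_ofPred_eq, chartInv_node hp.1.1 hp.1.2]
    exact (nodeAt_spec h hp.1.1.le hp.1.2).1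
  left_inv' z hz := by
    have h₀ := z.x_pos
    have h₁ := z.lt_top.trans_le (top_mono (show z.node ≤ h from hz))
    have h₂ := nodeAt_eq (show z.node ≤ h from hz) z.ht_le z.lt_top
    ext
    · rw [chartInv_node h₀ h₁, h₂]
    · rw [chartInv_x h₀ h₁]
    · rw [chartInv_w h₀ h₁]
      simp only [h₂]
      ring
  right_inv' p hp := by
    rw [chartInv_node hp.1.1 hp.1.2, chartInv_x hp.1.1 hp.1.2, chartInv_w hp.1.1 hp.1.2]
    ext <;> simp

theorem mem_target_iff {h : N} {p : ℝ × ℝ} : p ∈ (chart h).target ↔ 0 < p.1 ∧ p.1 < top h := by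
  simp [chart]

theorem mem_source_iff {h : N} {z : RoadSurface N} : z ∈ (chart h).source ↔ z.node ≤ h := Iff.rfl

theorem chart_apply (h : N) (z : RoadSurface N) :
    chart h z = (z.x, z.w - dir z.node h * slope z.node z.x) := rfl

theorem chart_symm_eq (h : N) : ⇑(chart h).symm = chartInv h := rfl

theorem isOpen_target (h : N) : IsOpen (chart h).target := isOpen_Ioo.prod isOpen_univ

/-- Two branches overlap exactly up to the end of the node where they meet. The shears of all lower
tiles cancel, so the transition is a single shear in the tile of that node. -/
theorem exists_transition (h h' : N) : ∃ (j : N) (C : ℝ),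
    ((chart h).symm.trans (chart h')).source = (chart h).target ∩ {p | p.1 < top j} ∧
    EqOn ((chart h).symm.trans (chart h')) (fun p => (p.1, p.2 + C * slope j p.1))
      ((chart h).target ∩ {p | p.1 < top j}) := by
  obtain ⟨j, C, hj⟩ := exists_meet h h'
  refine ⟨j, C, ?_, ?_⟩
  · ext p
    rw [PartialEquiv.trans_source, PartialEquiv.symm_source]
    refine and_congr_right fun hp => ?_
    obtain ⟨h0, h1⟩ := mem_target_iff.1 hp
    rw [mem_preimage, mem_source_iff, chart_symm_eq, chartInv_node h0 h1]
    exact (hj _ h0 h1).1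
  · rintro p ⟨hp, hpj⟩
    obtain ⟨h0, h1⟩ := mem_target_iff.1 hp
    simp only [PartialEquiv.coe_trans, Function.comp_apply, chart_symm_eq, chart_apply,
      chartInv_x h0 h1, chartInv_node h0 h1, chartInv_w h0 h1, Prod.mk.injEq, true_and]
    rw [← (hj _ h0 h1).2 hpj]
    ring

-- The charts define the topology; since the transitions are shears by multiples of a `slope`, only
-- the continuity of that function below `top` enters.
variable (N) in
noncomputable def chartedSpaceCore : ChartedSpaceCore (ℝ × ℝ) (RoadSurface N) where
  atlas := range chart
  chartAt z := chart z.node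
  mem_chart_source z := mem_source_iff.2 le_rfl
  chart_mem_atlas z := mem_range_self _
  open_source := by
    rintro _ _ ⟨h, rfl⟩ ⟨h', rfl⟩
    obtain ⟨j, C, h1, -⟩ := exists_transition h h'
    rw [h1]
    exact (isOpen_target h).inter (isOpen_lt (by fun_prop) (by fun_prop))
  continuousOn_toFun := by
    rintro _ _ ⟨h, rfl⟩ ⟨h', rfl⟩
    obtain ⟨j, C, h1, h2⟩ := exists_transition h h'
    rw [h1]
    refine ContinuousOn.congr ?_ h2
    refine ContinuousOn.prodMk (by fun_prop) (ContinuousOn.add (by fun_prop)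
      (ContinuousOn.mul (by fun_prop) ?_))
    exact (continuousOn_slope j).comp (by fun_prop) fun p hp => hp.2

noncomputable instance : TopologicalSpace (RoadSurface N) :=
  (chartedSpaceCore N).toTopologicalSpace

/-- The chart along the branch of `h` as a partial homeomorphism. -/
noncomputable def openChart (h : N) : OpenPartialHomeomorph (RoadSurface N) (ℝ × ℝ) :=
  (chartedSpaceCore N).openPartialHomeomorph (chart h) (mem_range_self h)

theorem isOpen_source (h : N) : IsOpen {z : RoadSurface N | z.node ≤ h} := (openChart h).open_source

theorem continuousOn_chart (h : N) : ContinuousOn (chart h) {z : RoadSurface N | z.node ≤ h} :=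
  (openChart h).continuousOn

theorem continuousOn_chartInv (h : N) : ContinuousOn (chartInv h) (chart h).target :=
  (openChart h).continuousOn_symm

theorem chartInv_chart {h : N} {z : RoadSurface N} (hz : z.node ≤ h) : chartInv h (chart h z) = z :=
  (chart h).left_inv hz

theorem chart_mem_target {h : N} {z : RoadSurface N} (hz : z.node ≤ h) :
    chart h z ∈ (chart h).target := (chart h).map_source hz

/-- A map is continuous as soon as it is so in all charts. -/
theorem continuous_of_chart {Y Z : Type*} [TopologicalSpace Y] [TopologicalSpace Z]
    {F : Y × RoadSurface N → Z}
    (hF : ∀ h : N, ContinuousOn (fun q : Y × (ℝ × ℝ) => F (q.1, chartInv h q.2))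
      (univ ×ˢ (chart h).target)) : Continuous F := by
  rw [continuous_iff_continuousAt]
  rintro ⟨y, z⟩
  have hV : (univ ×ˢ {z' : RoadSurface N | z'.node ≤ z.node}) ∈ 𝓝 (y, z) :=
    (isOpen_univ.prod (isOpen_source _)).mem_nhds ⟨trivial, le_rfl⟩
  have h1 : ContinuousOn (fun q : Y × RoadSurface N => (q.1, chart z.node q.2))
      (univ ×ˢ {z' : RoadSurface N | z'.node ≤ z.node}) :=
    continuousOn_fst.prodMk ((continuousOn_chart z.node).comp continuousOn_snd fun q hq => hq.2)
  have h2 := (hF z.node).comp h1 fun q hq => ⟨trivial, chart_mem_target hq.2⟩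
  refine (ContinuousOn.congr h2 ?_).continuousAt hV
  rintro ⟨y', z'⟩ hz'
  simp only [Function.comp_apply]
  rw [chartInv_chart hz'.2]

theorem continuous_of_chart' {Z : Type*} [TopologicalSpace Z] {F : RoadSurface N → Z}
    (hF : ∀ h : N, ContinuousOn (fun p : ℝ × ℝ => F (chartInv h p)) (chart h).target) :
    Continuous F := by
  have : Continuous fun q : Unit × RoadSurface N => F q.2 :=
    continuous_of_chart fun h => (hF h).comp continuousOn_snd fun q hq => hq.2
  exact this.comp (by fun_prop : Continuous fun z : RoadSurface N => ((), z))

theorem continuous_x : Continuous (x : RoadSurface N → ℝ) :=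
  continuous_of_chart' fun _ => continuousOn_fst.congr fun _ hp =>
    chartInv_x (mem_target_iff.1 hp).1 (mem_target_iff.1 hp).2

/-- Above height `ht k`, points near the half planes above `k` lie in these half planes. -/
theorem isOpen_setOf_le_node (k : N) : IsOpen {z : RoadSurface N | k ≤ z.node ∧ ht k < z.x} := by
  rw [isOpen_iff_mem_nhds]
  rintro z ⟨hz, hx⟩
  have : {z' : RoadSurface N | z'.node ≤ z.node} ∩ {z' | ht k < z'.x} ∈ 𝓝 z :=
    ((isOpen_source _).inter (isOpen_lt continuous_const continuous_x)).mem_nhds ⟨le_rfl, hx⟩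
  refine mem_of_superset this ?_
  rintro z' ⟨h1, h2⟩
  exact ⟨le_of_ht_le hz h1 (le_of_lt h2) z'.lt_top, h2⟩

theorem not_le_of_dir_ne {j h h' k : N} (hne : dir j h ≠ dir j h') (hk : j < k)
    (hkh : k ≤ h) : ¬ k ≤ h' := fun hk' =>
  hne ((dir_eq hk hkh).trans (dir_eq hk hk').symm)

/-- Points of different height are separated by x, points at comparable nodes by a common chart.
Otherwise the branches leave a node j in different integer directions d ≠ d'. Lines of these
directions are |d - d'| times the slope apart, which is unbounded near the upper end of j. -/
instance : T2Space (RoadSurface N) := by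
  refine ⟨fun z z' hne => ?_⟩
  rcases eq_or_ne z.x z'.x with hx | hx
  swap
  · obtain ⟨U, V, hU, hV, h1, h2, hd⟩ := t2_separation hx
    exact ⟨_, _, hU.preimage continuous_x, hV.preimage continuous_x, h1, h2,
      hd.preimage _⟩
  have hcomp : ∀ h : N, z.node ≤ h → z'.node ≤ h → ∃ u v : Set (RoadSurface N), IsOpen u ∧
      IsOpen v ∧ z ∈ u ∧ z' ∈ v ∧ Disjoint u v := by
    intro h hz hz'
    have : chart h z ≠ chart h z' := fun he => hne ((chart h).injOn hz hz' he)
    obtain ⟨U, V, hU, hV, h1, h2, hd⟩ := t2_separation this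
    refine ⟨_, _, (continuousOn_chart h).isOpen_inter_preimage (isOpen_source h) hU,
      (continuousOn_chart h).isOpen_inter_preimage (isOpen_source h) hV, ⟨hz, h1⟩, ⟨hz', h2⟩, ?_⟩
    exact (hd.preimage _).mono inter_subset_right inter_subset_right
  by_cases h1 : z.node ≤ z'.node
  · exact hcomp _ h1 le_rfl
  by_cases h2 : z'.node ≤ z.node
  · exact hcomp _ le_rfl h2
  obtain ⟨j, hj, hj', hd⟩ := exists_dir_ne h1 h2
  have hbd : ∀ y : RoadSurface N, IsOpen ({q : RoadSurface N | q.node ≤ y.node} ∩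
      {q | (chart y.node q).2 ∈ Ioo (y.w - 1) (y.w + 1)}) := fun y =>
    (continuousOn_snd.comp (continuousOn_chart y.node) (mapsTo_univ _ _)).isOpen_inter_preimage
      (isOpen_source _) isOpen_Ioo
  have hmem : ∀ y : RoadSurface N, (chart y.node y).2 ∈ Ioo (y.w - 1) (y.w + 1) := by
    intro y
    rw [chart_apply, dir_self]
    simp
  have htop : top j ≤ z.x := (top_le_ht hj).trans z.ht_le
  set R := |z.w| + |z'.w| + 2 with hR
  have hRpos : 0 < R := by positivity
  have hy : ∃ y, ht j < y ∧ y < top j ∧ ∀ x, y < x → x < top j → R < slope j x := by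
    have hl := len_pos j
    have hlt : len j / (R + 1) < len j := div_lt_self hl (by linarith)
    have hlp : 0 < len j / (R + 1) := by positivity
    -- The slope at x exceeds R exactly when (R + 1)(top j - x) < len j.
    refine ⟨top j - len j / (R + 1), ?_, by linarith, fun x hx1 hx2 => ?_⟩
    · rw [top]; linarith
    · rw [slope_of_ge (by rw [top] at hx1; linarith), lt_div_iff₀ (by linarith)]
      have h3 : top j - x < len j / (R + 1) := by linarith
      rw [lt_div_iff₀ (by linarith)] at h3
      have : len j = top j - ht j := by rw [top]; ring
      linarith
  obtain ⟨y, hy1, hy2, hy3⟩ := hy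
  refine ⟨_, _, (hbd z).inter (isOpen_lt continuous_const continuous_x),
    (hbd z').inter (isOpen_lt continuous_const continuous_x), ⟨⟨le_rfl, hmem z⟩, show y < z.x by linarith⟩,
    ⟨⟨le_rfl, hmem z'⟩, show y < z'.x by linarith⟩, ?_⟩
  rw [Set.disjoint_left]
  rintro q ⟨⟨hq1, hq2⟩, hq3⟩ ⟨⟨hq1', hq2'⟩, -⟩
  simp only [mem_ofPred_eq] at hq1 hq2 hq3 hq1' hq2'
  have hjq : j ≤ q.node := le_of_ht_le hj.le hq1 (by linarith) q.lt_top
  -- A common point lies in the half plane of j itself, since no node above j is below both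
  -- branches.
  rcases hjq.eq_or_lt with he | hlt
  swap
  · exact not_le_of_dir_ne hd hlt hq1 hq1'
  simp only [chart_apply, ← he, mem_Ioo] at hq2 hq2'
  have hs := hy3 q.x hq3 (by rw [he]; exact q.lt_top)
  have hint : (1 : ℝ) ≤ |(dir j z.node : ℝ) - dir j z'.node| := by
    have : (1 : ℤ) ≤ |dir j z.node - dir j z'.node| := Int.one_le_abs (sub_ne_zero.2 hd)
    exact_mod_cast this
  have hle : |((dir j z.node : ℝ) - dir j z'.node) * slope j q.x| < R := by
    have := le_abs_self z.w
    have := le_abs_self z'.w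
    have := neg_abs_le z.w
    have := neg_abs_le z'.w
    rw [abs_lt]
    constructor <;> linarith
  rw [abs_mul, abs_of_pos (hRpos.trans hs)] at hle
  nlinarith

/-- A chart is cut down to the preimage of a ball, and the ball is stretched to the whole plane. -/
theorem locallyEuclidean (z : RoadSurface N) :
    ∃ U ∈ 𝓝 z, Nonempty (U ≃ₜ EuclideanSpace ℝ (Fin 2)) := by
  let L : (ℝ × ℝ) ≃ₜ EuclideanSpace ℝ (Fin 2) :=
    (Homeomorph.finTwoArrow (X := ℝ)).symm.trans (EuclideanSpace.equiv (Fin 2) ℝ).symm.toHomeomorph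
  let e := (openChart z.node).trans L.toOpenPartialHomeomorph
  have hz : z ∈ e.source := by
    simp only [e, OpenPartialHomeomorph.trans_source, Homeomorph.toOpenPartialHomeomorph_source,
      preimage_univ, inter_univ]
    exact le_rfl
  obtain ⟨r, hr, hb⟩ := Metric.isOpen_iff.1 e.open_target _ (e.map_source hz)
  let b := OpenPartialHomeomorph.univBall (e z) r
  have hbt : b.target = Metric.ball (e z) r := OpenPartialHomeomorph.univBall_target _ hr
  let g := e.trans b.symm
  have hgs : z ∈ g.source := by
    simp only [g, OpenPartialHomeomorph.trans_source, OpenPartialHomeomorph.symm_source]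
    refine ⟨hz, ?_⟩
    rw [mem_preimage, hbt]
    exact Metric.mem_ball_self hr
  have hgt : g.target = univ := by
    rw [OpenPartialHomeomorph.trans_target]
    simp only [OpenPartialHomeomorph.symm_target, b, OpenPartialHomeomorph.univBall_source,
      univ_inter, OpenPartialHomeomorph.symm_symm]
    refine eq_univ_of_forall fun p => hb ?_
    rw [← hbt]
    exact b.map_source (by simp [b])
  exact ⟨g.source, g.open_source.mem_nhds hgs,
    ⟨g.toHomeomorphSourceTarget.trans ((Homeomorph.setCongr hgt).trans (Homeomorph.Set.univ _))⟩⟩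

end RoadSurface

/-! ### Scaling functions along a branch -/

namespace RoadTree

variable {N : Type} [PartialOrder N] [OrderBot N] [RoadTree N]

/-- A function given on the tiles of a branch is continuous if it is so on every tile and, uniformly
in the tiles below, at the lower end of each tile. -/
theorem continuousOn_nodeAt {Y : Type*} [TopologicalSpace Y] {Q : N → Y → ℝ → ℝ}
    (hQ : ∀ k, ContinuousOn (fun q : Y × ℝ => Q k q.1 q.2) (univ ×ˢ Ico (ht k) (top k)))
    (hQ' : ∀ k y ε, 0 < ε → ∃ V ∈ 𝓝 y, ∃ δ > 0, ∀ y' ∈ V, ∀ j < k, ∀ x, ht j ≤ x → x < top j →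
      ht k - δ < x → |Q j y' x - Q k y (ht k)| < ε) (h : N) :
    ContinuousOn (fun q : Y × ℝ => Q (nodeAt h q.2) q.1 q.2) (univ ×ˢ Ioo 0 (top h)) := by
  rintro ⟨y₀, x₀⟩ ⟨-, h0, h1⟩
  apply ContinuousAt.continuousWithinAt
  simp only at h0 h1
  obtain ⟨hk, hk1, hk2⟩ := nodeAt_spec h h0.le h1
  set k := nodeAt h x₀ with hkdef
  have hright : ∀ ε > 0, ∀ᶠ q : Y × ℝ in 𝓝 (y₀, x₀), ht k ≤ q.2 →
      |Q k q.1 q.2 - Q k y₀ x₀| < ε := by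
    intro ε hε
    have := hQ k (y₀, x₀) ⟨trivial, hk1, hk2⟩
    have := (Metric.tendsto_nhds.1 this) ε hε
    rw [eventually_nhdsWithin_iff] at this
    have hlt : ∀ᶠ q : Y × ℝ in 𝓝 (y₀, x₀), q.2 < top k :=
      (isOpen_lt continuous_snd continuous_const).mem_nhds hk2
    filter_upwards [this, hlt] with q hq hq2 hq1
    exact hq ⟨trivial, hq1, hq2⟩
  have hleft : ∀ ε > 0, ∀ᶠ q : Y × ℝ in 𝓝 (y₀, x₀), q.2 < ht k →
      |Q (nodeAt h q.2) q.1 q.2 - Q k y₀ x₀| < ε := by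
    intro ε hε
    -- Lower tiles matter only at the lower end of k. If k has no immediate predecessor, infinitely
    -- many of them accumulate there, hence the uniformity in `hQ'`.
    rcases hk1.eq_or_lt with he | hlt
    · obtain ⟨V, hV, δ, hδ, hVδ⟩ := hQ' k y₀ ε hε
      have h2 : ∀ᶠ q : Y × ℝ in 𝓝 (y₀, x₀), 0 < q.2 :=
        (isOpen_lt continuous_const continuous_snd).mem_nhds h0
      have h3 : ∀ᶠ q : Y × ℝ in 𝓝 (y₀, x₀), x₀ - δ < q.2 :=
        (isOpen_lt continuous_const continuous_snd).mem_nhds (by simpa using hδ)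
      have h4 : ∀ᶠ q : Y × ℝ in 𝓝 (y₀, x₀), q.1 ∈ V := continuous_fst.continuousAt hV
      filter_upwards [h2, h3, h4] with q hq2 hq3 hq4 hq
      obtain ⟨hj, hj1, hj2⟩ := nodeAt_spec h hq2.le (by linarith : q.2 < top h)
      have hjk : nodeAt h q.2 < k := by
        refine lt_of_le_of_ne (le_of_ht_le hj hk hj1 (by linarith)) fun hjk => ?_
        rw [hjk] at hj1
        linarith
      rw [← he]
      exact hVδ _ hq4 _ hjk _ hj1 hj2 (by linarith)
    · have h2 : ∀ᶠ q : Y × ℝ in 𝓝 (y₀, x₀), ht k < q.2 :=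
        (isOpen_lt continuous_const continuous_snd).mem_nhds hlt
      filter_upwards [h2] with q hq hq'
      exact absurd hq' (not_lt.2 hq.le)
  refine Metric.tendsto_nhds.2 fun ε hε => ?_
  have hlt : ∀ᶠ q : Y × ℝ in 𝓝 (y₀, x₀), q.2 < top k :=
    (isOpen_lt continuous_snd continuous_const).mem_nhds hk2
  filter_upwards [hright ε hε, hleft ε hε, hlt] with q hq1 hq2 hq3
  rw [Real.dist_eq]
  rcases lt_or_ge q.2 (ht k) with hq | hq
  · exact hq2 hq
  · simp only [nodeAt_eq hk hq hq3]
    exact hq1 hq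

/-- The factor by which the half plane of `k` is squeezed at height `x`. -/
noncomputable def squeezeFactor (k : N) (x : ℝ) : ℝ := √((x - ht k) * (top k - x))

/-- The interpolation between the factor `1` and `squeezeFactor`. -/
noncomputable def factor (k : N) (t : I) (x : ℝ) : ℝ := t + (1 - t) * squeezeFactor k x

/-- The height at which the slope is `factor` times the slope at `x`. -/
noncomputable def newHeight (k : N) (t : I) (x : ℝ) : ℝ :=
  ht k + len k * (factor k t x * (x - ht k) / ((top k - x) + factor k t x * (x - ht k)))

theorem squeezeFactor_nonneg (k : N) (x : ℝ) : 0 ≤ squeezeFactor k x := Real.sqrt_nonneg _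

theorem squeezeFactor_pos {k : N} {x : ℝ} (h₁ : ht k < x) (h₂ : x < top k) :
    0 < squeezeFactor k x :=
  Real.sqrt_pos.2 (mul_pos (by linarith) (by linarith))

theorem squeezeFactor_ht (k : N) : squeezeFactor k (ht k) = 0 := by simp [squeezeFactor]

theorem squeezeFactor_le_one {k : N} {x : ℝ} (h₁ : ht k ≤ x) (h₂ : x < top k) :
    squeezeFactor k x ≤ 1 := by
  have := len_le_one k
  rw [squeezeFactor, Real.sqrt_le_one]
  rw [top] at *
  nlinarith

theorem squeezeFactor_le_factor {k : N} {x : ℝ} (t : I) (h₁ : ht k ≤ x) (h₂ : x < top k) :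
    squeezeFactor k x ≤ factor k t x := by
  have := squeezeFactor_le_one h₁ h₂
  have := t.2.1
  rw [factor]
  nlinarith

theorem factor_nonneg (k : N) (t : I) (x : ℝ) : 0 ≤ factor k t x := by
  have := squeezeFactor_nonneg k x
  have := t.2.1
  have := t.2.2
  rw [factor]
  nlinarith

theorem newHeight_denominator_pos {k : N} {x : ℝ} (t : I) (h₁ : ht k ≤ x) (h₂ : x < top k) :
    0 < (top k - x) + factor k t x * (x - ht k) :=
  add_pos_of_pos_of_nonneg (by linarith) (mul_nonneg (factor_nonneg _ _ _) (by linarith))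

theorem ht_le_newHeight {k : N} {x : ℝ} (t : I) (h₁ : ht k ≤ x) (h₂ : x < top k) :
    ht k ≤ newHeight k t x :=
  le_add_of_nonneg_right (mul_nonneg (len_pos k).le
    (div_nonneg (mul_nonneg (factor_nonneg _ _ _) (by linarith))
      (newHeight_denominator_pos t h₁ h₂).le))

theorem top_sub_newHeight {k : N} {x : ℝ} (t : I) (h₁ : ht k ≤ x) (h₂ : x < top k) :
    top k - newHeight k t x =
      len k * (top k - x) / ((top k - x) + factor k t x * (x - ht k)) := by
  have := (newHeight_denominator_pos t h₁ h₂).ne'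
  have hl : len k = top k - ht k := by rw [top]; ring
  rw [newHeight, hl]
  field_simp
  ring

theorem newHeight_lt_top {k : N} {x : ℝ} (t : I) (h₁ : ht k ≤ x) (h₂ : x < top k) :
    newHeight k t x < top k := by
  rw [← sub_pos, top_sub_newHeight t h₁ h₂]
  exact div_pos (mul_pos (len_pos k) (by linarith)) (newHeight_denominator_pos t h₁ h₂)

/-- Slope s occurs at height ht k + len k · s / (1 + s). Inserting s = μ (x - ht k) / (top k - x),
with μ the factor, gives the formula for `newHeight`. -/
theorem slope_newHeight {k : N} {x : ℝ} (t : I) (h₁ : ht k ≤ x) (h₂ : x < top k) :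
    slope k (newHeight k t x) = factor k t x * slope k x := by
  rw [slope_of_ge (ht_le_newHeight t h₁ h₂), top_sub_newHeight t h₁ h₂, slope_of_ge h₁]
  have h3 := (newHeight_denominator_pos t h₁ h₂).ne'
  have h4 := (len_pos k).ne'
  have h5 : top k - x ≠ 0 := by linarith
  rw [newHeight]
  field_simp
  ring

theorem newHeight_pos {k : N} {x : ℝ} (t : I) (h₀ : 0 < x) (h₁ : ht k ≤ x) (h₂ : x < top k) :
    0 < newHeight k t x := by
  rcases (ht_nonneg k).eq_or_lt with h | h
  · have hx : ht k < x := by linarith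
    refine add_pos_of_nonneg_of_pos (ht_nonneg k) (mul_pos (len_pos k)
      (div_pos (mul_pos ?_ (by linarith)) (newHeight_denominator_pos t h₁ h₂)))
    exact (squeezeFactor_pos hx h₂).trans_le (squeezeFactor_le_factor t h₁ h₂)
  · exact h.trans_le (ht_le_newHeight t h₁ h₂)

theorem newHeight_ht (k : N) (t : I) : newHeight k t (ht k) = ht k := by simp [newHeight]

theorem factor_ht (k : N) (t : I) : factor k t (ht k) = t := by simp [factor, squeezeFactor_ht]

theorem factor_one (k : N) (x : ℝ) : factor k 1 x = 1 := by simp [factor]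

theorem newHeight_one (k : N) {x : ℝ} : newHeight k 1 x = x := by
  have := (len_pos k).ne'
  rw [newHeight, factor_one, top]
  have h : ht k + len k - x + 1 * (x - ht k) = len k := by ring
  rw [h]
  field_simp
  ring

theorem continuous_squeezeFactor (k : N) : Continuous (squeezeFactor k) := by
  unfold squeezeFactor
  fun_prop

theorem continuous_factor (k : N) : Continuous fun q : I × ℝ => factor k q.1 q.2 := by
  unfold factor
  have := continuous_squeezeFactor k
  fun_prop

/-- One term of the product is at most len j ≤ 1, the other at most ht k - x. Hence `factor j t`
tends to t, its value at the lower end of k, uniformly in the tiles below k. -/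
theorem squeezeFactor_sq_le {j k : N} (hj : j < k) {x : ℝ} (h₁ : ht j ≤ x) (h₂ : x < top j) :
    squeezeFactor j x ^ 2 ≤ ht k - x := by
  rw [squeezeFactor, Real.sq_sqrt (mul_nonneg (by linarith) (by linarith))]
  have h3 := top_le_ht hj
  have h4 := len_le_one j
  have h5 : x - ht j ≤ 1 := by rw [top] at h₂; linarith
  nlinarith

theorem exists_squeezeFactor_lt (k : N) {ε : ℝ} (hε : 0 < ε) :
    ∃ δ > 0, ∀ j < k, ∀ x, ht j ≤ x → x < top j → ht k - δ < x → squeezeFactor j x < ε := by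
  refine ⟨ε ^ 2, by positivity, fun j hj x h₁ h₂ h₃ => ?_⟩
  have := squeezeFactor_sq_le hj h₁ h₂
  exact lt_of_pow_lt_pow_left₀ 2 hε.le (by linarith)

theorem continuousOn_factor (h : N) :
    ContinuousOn (fun q : I × ℝ => factor (nodeAt h q.2) q.1 q.2) (univ ×ˢ Ioo 0 (top h)) := by
  refine continuousOn_nodeAt (fun k => (continuous_factor k).continuousOn) (fun k t ε hε => ?_) h
  obtain ⟨δ, hδ, hs⟩ := exists_squeezeFactor_lt k (half_pos hε)
  refine ⟨Metric.ball t (ε / 2), Metric.ball_mem_nhds _ (half_pos hε), δ, hδ,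
    fun t' ht' j hj x h₁ h₂ h₃ => ?_⟩
  have h4 := hs j hj x h₁ h₂ h₃
  have h5 := squeezeFactor_nonneg j x
  have h6 := t'.2.1
  have h7 := t'.2.2
  have h8 : |(t' : ℝ) - t| < ε / 2 := by simpa [Subtype.dist_eq, Real.dist_eq] using ht'
  rw [factor_ht, factor]
  rw [abs_lt] at h8 ⊢
  constructor <;> nlinarith

/-- Write A = x - ht j and B = top j - x. The new slope is at least √(AB) · A / B, which still tends
to infinity as B tends to 0, so the upper end stays in place. Here the square root matters: a factor
vanishing linearly in B would keep the slope bounded. -/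
theorem top_sub_newHeight_le {j k : N} (hj : j < k) {x e : ℝ} (t : I) (h₁ : ht j ≤ x)
    (h₂ : x < top j) (he : 0 < e) (he' : e ≤ 1) (hx : ht k - e ^ 5 < x) :
    top j - newHeight j t x ≤ 2 * e := by
  have h3 := len_le_one j
  have hB : top j - x < e ^ 5 := by linarith [top_le_ht hj]
  have hB0 : 0 < top j - x := by linarith
  have hA0 : 0 ≤ x - ht j := by linarith
  have hlen : len j = (x - ht j) + (top j - x) := by rw [top]; ring
  rw [top_sub_newHeight t h₁ h₂, div_le_iff₀ (newHeight_denominator_pos t h₁ h₂)]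
  have hμ := mul_nonneg (factor_nonneg j t x) hA0
  -- In a short tile nothing moves by more than its length; in a longer one A ≥ e.
  rcases le_or_gt (len j) (2 * e) with hl | hl
  · nlinarith
  · have he5 : e ^ 5 ≤ e := by
      calc e ^ 5 ≤ e ^ 1 := pow_le_pow_of_le_one he.le he' (by norm_num)
        _ = e := pow_one e
    have hA : e ≤ x - ht j := by linarith
    -- From B ≤ e⁵ ≤ e⁴ A it follows that B² ≤ e⁴ A B. The two powers of e gained here are spent on
    -- A ≥ e and on the final bound.
    have hsq : top j - x ≤ e ^ 2 * squeezeFactor j x := by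
      have h4 : e ^ 2 * squeezeFactor j x = √((e ^ 2) ^ 2 * ((x - ht j) * (top j - x))) := by
        rw [Real.sqrt_mul (by positivity), Real.sqrt_sq (by positivity)]
        rfl
      rw [h4]
      apply Real.le_sqrt_of_sq_le
      have h5 : top j - x ≤ (e ^ 2) ^ 2 * (x - ht j) := by
        have : e ^ 5 ≤ (e ^ 2) ^ 2 * (x - ht j) := by
          have : e ^ 5 = (e ^ 2) ^ 2 * e := by ring
          rw [this]
          gcongr
        linarith
      nlinarith
    have h6 : squeezeFactor j x ≤ factor j t x := squeezeFactor_le_factor t h₁ h₂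
    have h7 : e ^ 2 * squeezeFactor j x ≤ e * (factor j t x * (x - ht j)) := by
      have h8 := squeezeFactor_nonneg j x
      have : e * squeezeFactor j x ≤ (x - ht j) * factor j t x :=
        mul_le_mul hA h6 h8 hA0
      nlinarith
    have h9 : len j * (top j - x) ≤ top j - x := by nlinarith
    nlinarith

theorem continuousOn_newHeight (h : N) :
    ContinuousOn (fun q : I × ℝ => newHeight (nodeAt h q.2) q.1 q.2)
      (univ ×ˢ Ioo 0 (top h)) := by
  refine continuousOn_nodeAt (fun k => ?_) (fun k t ε hε => ?_) h
  · have := continuous_factor k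
    unfold newHeight
    refine ContinuousOn.add (by fun_prop) (ContinuousOn.mul (by fun_prop)
      (ContinuousOn.div (by fun_prop) (by fun_prop) fun q hq => ?_))
    exact (newHeight_denominator_pos _ hq.2.1 hq.2.2).ne'
  · set e := min 1 (ε / 4) with he
    have he0 : 0 < e := lt_min one_pos (by linarith)
    have he1 : e ≤ 1 := min_le_left _ _
    have he2 : e ≤ ε / 4 := min_le_right _ _
    refine ⟨univ, univ_mem, e ^ 5, by positivity, fun t' _ j hj x h₁ h₂ h₃ => ?_⟩
    have h4 := top_sub_newHeight_le hj t' h₁ h₂ he0 he1 h₃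
    have h5 := newHeight_lt_top t' h₁ h₂
    have h6 := top_le_ht hj
    have he5 : e ^ 5 ≤ e := by
      calc e ^ 5 ≤ e ^ 1 := pow_le_pow_of_le_one he0.le he1 (by norm_num)
        _ = e := pow_one e
    rw [newHeight_ht, abs_lt]
    constructor <;> linarith

/-- The height `newHeight k 0 x`, cut off at `τ`. -/
noncomputable def cutHeight (k : N) (τ x : ℝ) : ℝ := min (newHeight k 0 x) τ

/-- The factor which belongs to `cutHeight`. -/
noncomputable def cutFactor (k : N) (τ x : ℝ) : ℝ := slope k (cutHeight k τ x) / slope k x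

theorem continuousOn_cutHeight (h : N) :
    ContinuousOn (fun q : ℝ × ℝ => cutHeight (nodeAt h q.2) q.1 q.2) (univ ×ˢ Ioo 0 (top h)) := by
  have : ContinuousOn (fun q : ℝ × ℝ => newHeight (nodeAt h q.2) 0 q.2) (univ ×ˢ Ioo 0 (top h)) :=
    (continuousOn_newHeight h).comp (f := fun q : ℝ × ℝ => ((0 : I), q.2)) (by fun_prop)
      fun q hq => ⟨trivial, hq.2⟩
  unfold cutHeight
  exact ContinuousOn.inf this (by fun_prop)

theorem cutHeight_lt_top {k : N} {τ x : ℝ} (h₁ : ht k ≤ x) (h₂ : x < top k) :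
    cutHeight k τ x < top k := (min_le_left _ _).trans_lt (newHeight_lt_top 0 h₁ h₂)

theorem cutFactor_mul_slope {k : N} {τ x : ℝ} (h₁ : ht k ≤ x) (h₂ : x < top k) :
    cutFactor k τ x * slope k x = slope k (cutHeight k τ x) := by
  rcases h₁.eq_or_lt with h | h
  · have : cutHeight k τ x ≤ ht k := by
      rw [cutHeight, ← h, newHeight_ht]
      exact min_le_left _ _
    rw [slope_of_le h.ge, slope_of_le this, mul_zero]
  · rw [cutFactor, div_mul_cancel₀ _ (slope_pos h h₂).ne']

theorem cutFactor_nonneg {k : N} {τ x : ℝ} (h₁ : ht k ≤ x) (h₂ : x < top k) :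
    0 ≤ cutFactor k τ x :=
  div_nonneg (slope_nonneg (cutHeight_lt_top h₁ h₂)) (slope_nonneg h₂)

theorem factor_zero (k : N) (x : ℝ) : factor k 0 x = squeezeFactor k x := by simp [factor]

/-- Cutting only lowers the height, hence the slope. The bound carries the continuity of
`squeezeFactor` at lower ends over to `cutFactor`. -/
theorem cutFactor_le {k : N} {τ x : ℝ} (h₁ : ht k ≤ x) (h₂ : x < top k) :
    cutFactor k τ x ≤ squeezeFactor k x := by
  rcases h₁.eq_or_lt with h | h
  · rw [cutFactor, slope_of_le h.ge, div_zero]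
    exact squeezeFactor_nonneg _ _
  · rw [cutFactor, div_le_iff₀ (slope_pos h h₂), ← factor_zero, ← slope_newHeight 0 h₁ h₂]
    exact slope_mono (min_le_left _ _) (newHeight_lt_top 0 h₁ h₂)

/-- The convention 0 / 0 = 0 gives the right value: the uncut factor vanishes here as well. -/
theorem cutFactor_ht (k : N) (τ : ℝ) : cutFactor k τ (ht k) = 0 := by
  rw [cutFactor, slope_of_le le_rfl, div_zero]

theorem continuousOn_cutFactor (h : N) :
    ContinuousOn (fun q : ℝ × ℝ => cutFactor (nodeAt h q.2) q.1 q.2) (univ ×ˢ Ioo 0 (top h)) := by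
  refine continuousOn_nodeAt (fun k => ?_) (fun k τ ε hε => ?_) h
  · rintro ⟨τ, x⟩ ⟨-, h₁, h₂⟩
    simp only at h₁ h₂
    rcases h₁.eq_or_lt with he | hlt
    · unfold ContinuousWithinAt
      simp only [← he, cutFactor_ht]
      have h0 : Tendsto (fun q : ℝ × ℝ => squeezeFactor k q.2)
          (𝓝[univ ×ˢ Ico (ht k) (top k)] (τ, ht k)) (𝓝 0) := by
        have := (((continuous_squeezeFactor k).comp continuous_snd).tendsto (τ, ht k))
        simp only [Function.comp_def, squeezeFactor_ht] at this
        exact this.mono_left nhdsWithin_le_nhds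
      refine squeeze_zero' ?_ ?_ h0
      · filter_upwards [self_mem_nhdsWithin] with q hq using cutFactor_nonneg hq.2.1 hq.2.2
      · filter_upwards [self_mem_nhdsWithin] with q hq using cutFactor_le hq.2.1 hq.2.2
    · have hs : ContinuousAt (slope k) x :=
        (continuousOn_slope k).continuousAt (Iio_mem_nhds h₂)
      have hn : ContinuousAt (fun q : ℝ × ℝ => newHeight k 0 q.2) (τ, x) := by
        have h1 := (continuousOn_newHeight k).continuousAt (x := ((0 : I), x))
          ((isOpen_univ.prod isOpen_Ioo).mem_nhds ⟨trivial, (ht_nonneg k).trans_lt hlt, h₂⟩)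
        have h2 : ContinuousAt (fun q : ℝ × ℝ => newHeight (nodeAt k q.2) 0 q.2) (τ, x) :=
          ContinuousAt.comp (g := fun q : I × ℝ => newHeight (nodeAt k q.2) q.1 q.2)
            (f := fun q : ℝ × ℝ => ((0 : I), q.2)) (x := (τ, x)) h1 (by fun_prop)
        refine h2.congr ?_
        have h3 : ∀ᶠ q : ℝ × ℝ in 𝓝 (τ, x), q.2 ∈ Ioo (ht k) (top k) :=
          continuous_snd.continuousAt (Ioo_mem_nhds hlt h₂)
        filter_upwards [h3] with q hq
        rw [nodeAt_eq le_rfl hq.1.le hq.2]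
      have hc : ContinuousAt (fun q : ℝ × ℝ => cutHeight k q.1 q.2) (τ, x) :=
        ContinuousAt.inf hn continuous_fst.continuousAt
      have hsc : ContinuousAt (slope k) (cutHeight k τ x) :=
        (continuousOn_slope k).continuousAt (Iio_mem_nhds (cutHeight_lt_top h₁ h₂))
      refine ContinuousAt.continuousWithinAt ?_
      refine ContinuousAt.div (ContinuousAt.comp (f := fun q : ℝ × ℝ => cutHeight k q.1 q.2)
        (x := (τ, x)) hsc hc)
        (ContinuousAt.comp (f := fun q : ℝ × ℝ => q.2) (x := (τ, x)) hs (by fun_prop))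
        (slope_pos hlt h₂).ne'
  · obtain ⟨δ, hδ, hs⟩ := exists_squeezeFactor_lt k hε
    refine ⟨univ, univ_mem, δ, hδ, fun τ' _ j hj x h₁ h₂ h₃ => ?_⟩
    rw [cutFactor_ht, sub_zero, abs_of_nonneg (cutFactor_nonneg h₁ h₂)]
    exact (cutFactor_le h₁ h₂).trans_lt (hs j hj x h₁ h₂ h₃)

end RoadTree

/-! ### Contractibility of the surface over a road tree -/

namespace RoadSurface

variable {N : Type} [PartialOrder N] [OrderBot N] [RoadTree N]

/-- Passing from h up to h' shears only the tile of h; lower tiles have the same direction towards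
both nodes, and `slope h` vanishes on them. -/
theorem chartInv_congr {h h' : N} {p : ℝ × ℝ} (hk : h ≤ h') (h₀ : 0 < p.1) (h₁ : p.1 < top h) :
    chartInv h p = chartInv h' (p.1, p.2 - dir h h' * slope h p.1) := by
  obtain ⟨hj, hj1, hj2⟩ := nodeAt_spec h h₀.le h₁
  have he : nodeAt h' p.1 = nodeAt h p.1 := nodeAt_eq (hj.trans hk) hj1 hj2
  have h₁' := h₁.trans_le (top_mono hk)
  ext
  · rw [chartInv_node h₀ h₁, chartInv_node (p := (p.1, p.2 - dir h h' * slope h p.1)) h₀ h₁', he]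
  · rw [chartInv_x h₀ h₁, chartInv_x (p := (p.1, p.2 - dir h h' * slope h p.1)) h₀ h₁']
  · rw [chartInv_w h₀ h₁, chartInv_w (p := (p.1, p.2 - dir h h' * slope h p.1)) h₀ h₁']
    simp only [he]
    rcases hj.eq_or_lt with hj | hj
    · rw [hj, dir_self]
      push_cast
      ring
    · rw [dir_eq hj hk, slope_of_le (hj2.le.trans (top_le_ht hj))]
      ring

/-- A map which is given by scaling in the half planes is diagonal in all charts. -/
theorem chartInv_scale {X M : N → ℝ → ℝ}
    (hX₀ : ∀ k x, 0 < x → ht k ≤ x → x < top k → 0 < X k x)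
    (hX₁ : ∀ k x, 0 < x → ht k ≤ x → x < top k → X k x < top k)
    (hM : ∀ k x, 0 < x → ht k ≤ x → x < top k → M k x * slope k x = slope k (X k x))
    {h : N} {p : ℝ × ℝ} (h₀ : 0 < p.1) (h₁ : p.1 < top h) :
    chartInv (chartInv h p).node (X (chartInv h p).node (chartInv h p).x,
        (chartInv h p).w * M (chartInv h p).node (chartInv h p).x) =
      chartInv h (X (nodeAt h p.1) p.1, p.2 * M (nodeAt h p.1) p.1) := by
  obtain ⟨hj, hj1, hj2⟩ := nodeAt_spec h h₀.le h₁
  rw [chartInv_node h₀ h₁, chartInv_x h₀ h₁, chartInv_w h₀ h₁,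
    chartInv_congr hj (hX₀ _ _ h₀ hj1 hj2) (hX₁ _ _ h₀ hj1 hj2)]
  simp only
  rw [← hM _ _ h₀ hj1 hj2]
  congr 2
  ring

/-- When w and the slope are multiplied by the same number, so is w - d · slope for every direction
d. In each chart the map is therefore (x, w) ↦ (X, M w), and only functions of the height along a
branch need to be continuous. -/
theorem continuous_scale {Y : Type*} [TopologicalSpace Y] {X M : N → Y → ℝ → ℝ}
    (hX₀ : ∀ k y x, 0 < x → ht k ≤ x → x < top k → 0 < X k y x)
    (hX₁ : ∀ k y x, 0 < x → ht k ≤ x → x < top k → X k y x < top k)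
    (hM : ∀ k y x, 0 < x → ht k ≤ x → x < top k → M k y x * slope k x = slope k (X k y x))
    (hXc : ∀ h, ContinuousOn (fun q : Y × ℝ => X (nodeAt h q.2) q.1 q.2) (univ ×ˢ Ioo 0 (top h)))
    (hMc : ∀ h, ContinuousOn (fun q : Y × ℝ => M (nodeAt h q.2) q.1 q.2)
      (univ ×ˢ Ioo 0 (top h))) :
    Continuous fun q : Y × RoadSurface N =>
      chartInv q.2.node (X q.2.node q.1 q.2.x, q.2.w * M q.2.node q.1 q.2.x) := by
  refine continuous_of_chart fun h => ?_
  have hmaps : MapsTo (fun q : Y × (ℝ × ℝ) => (q.1, q.2.1)) (univ ×ˢ (chart h).target)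
      (univ ×ˢ Ioo 0 (top h)) := fun q hq => ⟨trivial, hq.2.1⟩
  have h1 : ContinuousOn (fun q : Y × (ℝ × ℝ) => (X (nodeAt h q.2.1) q.1 q.2.1,
      q.2.2 * M (nodeAt h q.2.1) q.1 q.2.1)) (univ ×ˢ (chart h).target) :=
    ((hXc h).comp (by fun_prop) hmaps).prodMk
      (ContinuousOn.mul (by fun_prop) ((hMc h).comp (by fun_prop) hmaps))
  refine ((continuousOn_chartInv h).comp h1 ?_).congr ?_
  · rintro ⟨y, p⟩ ⟨-, hp⟩
    obtain ⟨h0, h1⟩ := mem_target_iff.1 hp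
    obtain ⟨hj, hj1, hj2⟩ := nodeAt_spec h h0.le h1
    exact mem_target_iff.2 ⟨hX₀ _ _ _ h0 hj1 hj2,
      (hX₁ _ _ _ h0 hj1 hj2).trans_le (top_mono hj)⟩
  · rintro ⟨y, p⟩ ⟨-, hp⟩
    obtain ⟨h0, h1⟩ := mem_target_iff.1 hp
    exact chartInv_scale (X := fun k x => X k y x) (M := fun k x => M k y x) (fun k => hX₀ k y)
      (fun k => hX₁ k y) (fun k => hM k y) h0 h1

theorem chartInv_node_self (z : RoadSurface N) : chartInv z.node (z.x, z.w) = z := by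
  have := chartInv_chart (le_refl z.node)
  rwa [chart_apply, dir_self, Int.cast_zero, zero_mul, sub_zero] at this

/-- The homotopy which squeezes the boundary lines of all half planes to points. -/
noncomputable def squeeze (q : I × RoadSurface N) : RoadSurface N :=
  chartInv q.2.node (newHeight q.2.node q.1 q.2.x, q.2.w * factor q.2.node q.1 q.2.x)

theorem continuous_squeeze : Continuous (squeeze (N := N)) :=
  continuous_scale (fun _ t _ h₀ h₁ h₂ => newHeight_pos t h₀ h₁ h₂)
    (fun _ t _ _ h₁ h₂ => newHeight_lt_top t h₁ h₂)
    (fun _ t _ _ h₁ h₂ => (slope_newHeight t h₁ h₂).symm) continuousOn_newHeight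
    continuousOn_factor

theorem squeeze_one (z : RoadSurface N) : squeeze (1, z) = z := by
  rw [squeeze]
  simp only [newHeight_one, factor_one, mul_one]
  exact chartInv_node_self z

/-- The map which squeezes the boundary lines of all half planes and then moves everything along
the tree to heights at most `τ`. -/
noncomputable def cut (q : {τ : ℝ // 0 < τ} × RoadSurface N) : RoadSurface N :=
  chartInv q.2.node (cutHeight q.2.node q.1 q.2.x, q.2.w * cutFactor q.2.node q.1 q.2.x)

theorem cutHeight_pos {k : N} {τ x : ℝ} (hτ : 0 < τ) (h₀ : 0 < x) (h₁ : ht k ≤ x)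
    (h₂ : x < top k) : 0 < cutHeight k τ x := lt_min (newHeight_pos 0 h₀ h₁ h₂) hτ

theorem continuous_cut : Continuous (cut (N := N)) := by
  have hmaps : ∀ h : N, MapsTo (fun q : {τ : ℝ // 0 < τ} × ℝ => ((q.1 : ℝ), q.2))
      (univ ×ˢ Ioo 0 (top h)) (univ ×ˢ Ioo 0 (top h)) := fun h q hq => ⟨trivial, hq.2⟩
  have hincl : Continuous fun q : {τ : ℝ // 0 < τ} × ℝ => ((q.1 : ℝ), q.2) := by fun_prop
  refine continuous_scale (X := fun k (τ : {τ : ℝ // 0 < τ}) x => cutHeight k τ x)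
    (M := fun k (τ : {τ : ℝ // 0 < τ}) x => cutFactor k τ x) ?_ ?_ ?_ ?_ ?_
  · exact fun _ τ _ h₀ h₁ h₂ => cutHeight_pos τ.2 h₀ h₁ h₂
  · exact fun _ _ _ _ h₁ h₂ => cutHeight_lt_top h₁ h₂
  · exact fun _ _ _ _ h₁ h₂ => cutFactor_mul_slope h₁ h₂
  · intro h
    exact (continuousOn_cutHeight h).comp hincl.continuousOn (hmaps h)
  · intro h
    have := (continuousOn_cutFactor h).comp hincl.continuousOn (hmaps h)
    simpa only [Function.comp_def] using this

theorem cut_eq_squeeze {τ : {τ : ℝ // 0 < τ}} (hτ : ∀ k : N, top k ≤ τ) (z : RoadSurface N) :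
    cut (τ, z) = squeeze (0, z) := by
  have h1 : cutHeight z.node τ z.x = newHeight z.node 0 z.x :=
    min_eq_left ((newHeight_lt_top 0 z.ht_le z.lt_top).le.trans (hτ _))
  have h2 : cutFactor z.node τ z.x = factor z.node 0 z.x := by
    rw [cutFactor, h1, slope_newHeight 0 z.ht_le z.lt_top, factor_zero]
    rcases z.ht_le.eq_or_lt with h | h
    · rw [← h, squeezeFactor_ht, zero_mul, zero_div]
    · rw [mul_div_cancel_right₀ _ (slope_pos h z.lt_top).ne']
  rw [cut, squeeze]
  simp only [h1, h2]

theorem cut_node_eq_bot {τ : {τ : ℝ // 0 < τ}} (hτ : (τ : ℝ) < top (⊥ : N)) (z : RoadSurface N) :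
    (cut (τ, z)).node = ⊥ := by
  have h0 := cutHeight_pos τ.2 z.x_pos z.ht_le z.lt_top
  have h1 : cutHeight z.node τ z.x < top (⊥ : N) := (min_le_right _ _).trans_lt hτ
  rw [cut, chartInv_node h0 (cutHeight_lt_top z.ht_le z.lt_top)]
  exact nodeAt_eq bot_le (by rw [ht_bot]; exact h0.le) h1

/-- Once squeezed, points can descend: `cut` gives factor 0 to a point sent below its own half
plane, so it follows the line w = 0 of its own chart. The bound τ runs from above all heights, where
nothing is cut, to half the height of the root, where the image lies in a convex chart domain. -/
theorem contractibleSpace : ContractibleSpace (RoadSurface N) := by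
  rw [contractible_iff_id_nullhomotopic]
  obtain ⟨b, hb⟩ := exists_bound (N := N)
  have hb0 : 0 < b := (top_pos (⊥ : N)).trans_le (hb ⊥)
  have hbot := half_pos (top_pos (⊥ : N))
  let path : I → {τ : ℝ // 0 < τ} := fun t => ⟨(1 - t) * b + t * (top (⊥ : N) / 2), by
    have h0 := t.2.1
    have h1 := t.2.2
    rcases h0.eq_or_lt with h | h
    · rw [← h]; simpa using hb0
    · exact add_pos_of_nonneg_of_pos (mul_nonneg (by linarith) hb0.le) (mul_pos h hbot)⟩
  have hpath : Continuous path := Continuous.subtype_mk (by fun_prop) _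
  have hp0 : path 0 = ⟨b, hb0⟩ := by simp [path]
  have hp1 : path 1 = ⟨top (⊥ : N) / 2, hbot⟩ := by simp [path]
  let squeezed : C(RoadSurface N, RoadSurface N) :=
    ⟨fun z => squeeze (0, z), continuous_squeeze.comp (by fun_prop)⟩
  let pushed : C(RoadSurface N, RoadSurface N) :=
    ⟨fun z => cut (path 1, z), continuous_cut.comp (by fun_prop)⟩
  have h1 : (ContinuousMap.id (RoadSurface N)).Homotopic squeezed :=
    ContinuousMap.Homotopic.symm
      ⟨⟨⟨squeeze, continuous_squeeze⟩, fun _ => rfl, fun z => squeeze_one z⟩⟩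
  have h2 : squeezed.Homotopic pushed :=
    ⟨⟨⟨fun q => cut (path q.1, q.2), continuous_cut.comp (by fun_prop)⟩, fun z => by
      show cut (path 0, z) = squeeze (0, z)
      rw [hp0]
      exact cut_eq_squeeze hb z, fun _ => rfl⟩⟩
  have hnode : ∀ z, (pushed z).node = ⊥ := fun z => by
    show (cut (path 1, z)).node = ⊥
    rw [hp1]
    exact cut_node_eq_bot (half_lt_self (top_pos _)) z
  let D : Set (ℝ × ℝ) := (chart (⊥ : N)).target
  have hD : ContractibleSpace D :=
    ((convex_Ioo 0 (top (⊥ : N))).prod convex_univ).contractibleSpace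
      ⟨(top (⊥ : N) / 2, 0), ⟨hbot, half_lt_self (top_pos _)⟩, trivial⟩
  let g : C(RoadSurface N, D) := ⟨fun z => ⟨chart ⊥ (pushed z), chart_mem_target (hnode z).le⟩,
    Continuous.subtype_mk ((continuousOn_chart ⊥).comp_continuous pushed.continuous
      fun z => (hnode z).le) _⟩
  let i : C(D, RoadSurface N) :=
    ⟨fun p => chartInv ⊥ p, (continuousOn_chartInv ⊥).comp_continuous continuous_subtype_val
      fun p => p.2⟩
  have h4 : pushed = (i.comp (ContinuousMap.id _)).comp g := by
    ext1 z
    exact (chartInv_chart (hnode z).le).symm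
  obtain ⟨z, hz⟩ : pushed.Nullhomotopic := by
    rw [h4]
    exact ((id_nullhomotopic _).comp_right _).comp_left _
  exact ⟨z, (h1.trans h2).trans hz⟩

theorem isSurface : IsSurface (RoadSurface N) where
  t2 := inferInstance
  connected := by
    have := contractibleSpace (N := N)
    infer_instance
  locallyEuclidean := locallyEuclidean

end RoadSurface

/-! ### The Type I property -/

namespace RoadSurface

variable {N : Type} [PartialOrder N] [OrderBot N] [RoadTree N]

theorem isLindelof_of_subset_source {k : N} {S : Set (RoadSurface N)}
    (hS : S ⊆ {z | z.node ≤ k}) : IsLindelof S := by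
  have h1 : IsLindelof (chart k '' S) := HereditarilyLindelofSpace.isLindelof _
  have h2 := h1.image_of_continuousOn ((continuousOn_chartInv k).mono (by
    rintro _ ⟨z, hz, rfl⟩
    exact chart_mem_target (hS hz)))
  convert h2
  rw [image_image]
  ext z
  constructor
  · exact fun hz => ⟨z, hz, chartInv_chart (hS hz)⟩
  · rintro ⟨z', hz', rfl⟩
    simpa only [chartInv_chart (hS hz')] using hz'

/-- The sets `{lvl < α}` are open as unions of chart domains. Their closures add at most level α and
are thus covered by countably many charts, in each of which every subset is Lindelöf. -/
theorem isTypeI {lvl : N → Ordinal.{0}} (hmono : ∀ j k, j ≤ k → lvl j ≤ lvl k)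
    (hω : ∀ k, lvl k < Ordinal.omega 1)
    (hc : ∀ α < Ordinal.omega 1, {k | lvl k < α}.Countable)
    (hlim : ∀ k α, (∀ j < k, lvl j < α) → lvl k ≤ α) : IsTypeI (RoadSurface N) := by
  have hsucc : ∀ α < Ordinal.omega.{0} 1, Order.succ α < Ordinal.omega 1 := fun α hα =>
    (Cardinal.isSuccLimit_omega 1).succ_lt hα
  have hcl : ∀ α, closure {z : RoadSurface N | lvl z.node < α} ⊆ {z | lvl z.node ≤ α} := by
    intro α z hz
    refine hlim _ _ fun j hj => ?_
    -- For each j below the node of z this neighbourhood of z contains a point of lower level than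
    -- α, and that point sits at or above j.
    have ho : IsOpen ({z : RoadSurface N | j ≤ z.node ∧ ht j < z.x}) := isOpen_setOf_le_node j
    obtain ⟨z', ⟨h1, -⟩, h2⟩ := mem_closure_iff.1 hz _ ho ⟨hj.le, (ht_lt_ht hj).trans_le z.ht_le⟩
    exact (hmono _ _ h1).trans_lt h2
  refine ⟨fun α => {z | lvl z.node < α}, fun α hα => ⟨?_, ?_⟩, fun α β hαβ _ z hz => ?_,
    fun z => ⟨_, hsucc _ (hω z.node), Order.lt_succ (lvl z.node)⟩⟩
  · have : {z : RoadSurface N | lvl z.node < α} = ⋃ k ∈ {k | lvl k < α}, {z | z.node ≤ k} := by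
      ext z
      simp only [mem_ofPred_eq, mem_iUnion, exists_prop]
      exact ⟨fun hz => ⟨_, hz, le_rfl⟩, fun ⟨k, hk, hz⟩ => (hmono _ _ hz).trans_lt hk⟩
    simp only [this]
    exact isOpen_biUnion fun k _ => isOpen_source k
  · have : closure {z : RoadSurface N | lvl z.node < α} =
        ⋃ k ∈ {k | lvl k < Order.succ α},
          (closure {z : RoadSurface N | lvl z.node < α} ∩ {z | z.node ≤ k}) := by
      ext z
      simp only [mem_ofPred_eq, mem_iUnion, exists_prop, mem_inter_iff]
      exact ⟨fun hz => ⟨z.node, Order.lt_succ_iff.2 (hcl α hz), hz, le_rfl⟩, fun ⟨_, _, hz, _⟩ => hz⟩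
    simp only
    rw [this]
    exact (hc _ (hsucc α hα)).isLindelof_biUnion fun k _ =>
      isLindelof_of_subset_source inter_subset_right
  · exact (hcl α hz).trans_lt hαβ

end RoadSurface

/-! ### Homeomorphisms induced by tree automorphisms -/

/-- An automorphism of a road tree which shears the half plane of each `k` by the integer
`shear k`. -/
structure RoadTree.Automorphism (N : Type) [PartialOrder N] [OrderBot N] [RoadTree N] where
  toOrderIso : N ≃o N
  shear : N → ℤ
  ht_eq : ∀ k, ht (toOrderIso k) = ht k
  len_eq : ∀ k, len (toOrderIso k) = len k
  dir_apply : ∀ {j h}, j < h → dir (toOrderIso j) (toOrderIso h) = dir j h + shear j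

namespace RoadTree.Automorphism

variable {N : Type} [PartialOrder N] [OrderBot N] [RoadTree N] (θ : RoadTree.Automorphism N)

theorem top_eq (k : N) : top (θ.toOrderIso k) = top k := by rw [top, top, θ.ht_eq, θ.len_eq]

theorem slope_eq (k : N) (x : ℝ) : slope (θ.toOrderIso k) x = slope k x := by
  rw [slope, slope, θ.ht_eq, θ.top_eq]

def symm : RoadTree.Automorphism N where
  toOrderIso := θ.toOrderIso.symm
  shear k := -θ.shear (θ.toOrderIso.symm k)
  ht_eq k := by rw [← θ.ht_eq, θ.toOrderIso.apply_symm_apply]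
  len_eq k := by rw [← θ.len_eq, θ.toOrderIso.apply_symm_apply]
  dir_apply {j h} hjh := by
    have := θ.dir_apply (θ.toOrderIso.symm.lt_iff_lt.2 hjh)
    rw [θ.toOrderIso.apply_symm_apply, θ.toOrderIso.apply_symm_apply] at this
    rw [this]
    ring

/-- The action of an automorphism of a tree on the surface. -/
noncomputable def map (z : RoadSurface N) : RoadSurface N where
  node := θ.toOrderIso z.node
  x := z.x
  w := z.w + θ.shear z.node * slope z.node z.x
  x_pos := z.x_pos
  ht_le := by rw [θ.ht_eq]; exact z.ht_le
  lt_top := by rw [θ.top_eq]; exact z.lt_top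

theorem map_node (z : RoadSurface N) : (θ.map z).node = θ.toOrderIso z.node := rfl

theorem map_x (z : RoadSurface N) : (θ.map z).x = z.x := rfl

theorem map_w (z : RoadSurface N) :
    (θ.map z).w = z.w + θ.shear z.node * slope z.node z.x := rfl

/-- Between the charts of h and its image, the shear in each tile below h is absorbed by the change
of direction. What remains is the shear in the tile of h, which starts with slope 0. -/
theorem continuous_map : Continuous θ.map := by
  refine RoadSurface.continuous_of_chart' fun h => ?_
  have hc : ContinuousOn (fun p : ℝ × ℝ => (p.1, p.2 + θ.shear h * slope h p.1))
      (RoadSurface.chart h).target := by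
    refine ContinuousOn.prodMk (by fun_prop) (ContinuousOn.add (by fun_prop)
      (ContinuousOn.mul (by fun_prop) ((continuousOn_slope h).comp (by fun_prop) fun p hp => ?_)))
    exact hp.1.2
  have hmaps : MapsTo (fun p : ℝ × ℝ => (p.1, p.2 + θ.shear h * slope h p.1))
      (RoadSurface.chart h).target (RoadSurface.chart (θ.toOrderIso h)).target := fun p hp =>
    ⟨⟨hp.1.1, by rw [θ.top_eq]; exact hp.1.2⟩, trivial⟩
  refine ((RoadSurface.continuousOn_chartInv (θ.toOrderIso h)).comp hc hmaps).congr fun p hp => ?_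
  obtain ⟨h0, h1⟩ := RoadSurface.mem_target_iff.1 hp
  obtain ⟨hk, hk1, hk2⟩ := nodeAt_spec h h0.le h1
  have h1' : p.1 < top (θ.toOrderIso h) := by rwa [θ.top_eq]
  have hn : nodeAt (θ.toOrderIso h) p.1 = θ.toOrderIso (nodeAt h p.1) :=
    nodeAt_eq (θ.toOrderIso.le_iff_le.2 hk) (by rwa [θ.ht_eq]) (by rwa [θ.top_eq])
  simp only [Function.comp_apply]
  ext
  · rw [RoadSurface.chartInv_node (p := (p.1, p.2 + θ.shear h * slope h p.1)) h0 h1', hn, map_node,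
      RoadSurface.chartInv_node h0 h1]
  · rw [RoadSurface.chartInv_x (p := (p.1, p.2 + θ.shear h * slope h p.1)) h0 h1', map_x,
      RoadSurface.chartInv_x h0 h1]
  · rw [RoadSurface.chartInv_w (p := (p.1, p.2 + θ.shear h * slope h p.1)) h0 h1', map_w,
      RoadSurface.chartInv_w h0 h1, RoadSurface.chartInv_node h0 h1, RoadSurface.chartInv_x h0 h1]
    simp only [hn, θ.slope_eq]
    rcases hk.eq_or_lt with he | hl
    · rw [he, dir_self, dir_self]
      push_cast
      ring
    · rw [θ.dir_apply hl, slope_of_le (hk2.le.trans (top_le_ht hl))]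
      push_cast
      ring

theorem map_symm_map (z : RoadSurface N) : θ.symm.map (θ.map z) = z := by
  ext
  · exact θ.toOrderIso.symm_apply_apply _
  · rfl
  · show z.w + θ.shear z.node * slope z.node z.x +
      ((-θ.shear (θ.toOrderIso.symm (θ.toOrderIso z.node)) : ℤ) : ℝ) *
        slope (θ.toOrderIso z.node) z.x = z.w
    rw [θ.toOrderIso.symm_apply_apply, θ.slope_eq]
    push_cast
    ring

theorem map_map_symm (z : RoadSurface N) : θ.map (θ.symm.map z) = z := by
  ext
  · exact θ.toOrderIso.apply_symm_apply _
  · rfl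
  · show z.w + ((-θ.shear (θ.toOrderIso.symm z.node) : ℤ) : ℝ) * slope z.node z.x +
      θ.shear (θ.toOrderIso.symm z.node) * slope (θ.toOrderIso.symm z.node) z.x = z.w
    rw [← θ.slope_eq (θ.toOrderIso.symm z.node), θ.toOrderIso.apply_symm_apply]
    push_cast
    ring

noncomputable def homeomorph : RoadSurface N ≃ₜ RoadSurface N where
  toFun := θ.map
  invFun := θ.symm.map
  left_inv := θ.map_symm_map
  right_inv := θ.map_map_symm
  continuous_toFun := θ.continuous_map
  continuous_invFun := θ.symm.continuous_map

end RoadTree.Automorphism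

/-!
### An Aronszajn tree of well-ordered closed sets of rational numbers
-/

namespace AronszajnTree

/-- `B` is a set of nonnegative rationals with a maximum, whose proper initial segments with a
maximum are on the levels `L γ`, `γ < β`, and hit all of them; the maximum is a successor in `B`
or the supremum of the smaller elements. -/
structure IsNode (β : Ordinal.{0}) (L : ∀ γ, γ < β → Set (Set ℚ)) (B : Set ℚ) : Prop where
  exists_isGreatest : ∃ q, IsGreatest B q
  zero_mem : (0 : ℚ) ∈ B
  nonneg : ∀ b ∈ B, 0 ≤ b
  exists_level : ∀ b ∈ B, ∀ c ∈ B, b < c → ∃ γ, ∃ h : γ < β, B ∩ Iic b ∈ L γ h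
  exists_mem : ∀ γ, ∀ h : γ < β, ∃ b ∈ B, (∃ c ∈ B, b < c) ∧ B ∩ Iic b ∈ L γ h
  isLUB : β ≠ 0 → ∀ q, IsGreatest B q →
    (∃ a, IsGreatest (B ∩ Iio q) a) ∨ IsLUB (B ∩ Iio q) q

/-- `B` is a node on level `β` with maximum `q` which extends `A`. -/
def IsExtension (β : Ordinal.{0}) (L : ∀ γ, γ < β → Set (Set ℚ)) (A : Set ℚ) (q : ℚ)
    (B : Set ℚ) : Prop :=
  IsNode β L B ∧ IsGreatest B q ∧ ∃ a, IsGreatest A a ∧ B ∩ Iic a = A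

-- Choosing one extension for each pair of a lower node and a rational keeps the levels countable.
-- The default {0} adds nothing on positive levels, where a node needs a proper initial segment on
-- level 0.
open Classical in
noncomputable def extension (β : Ordinal.{0}) (L : ∀ γ, γ < β → Set (Set ℚ)) (p : Set ℚ × ℚ) :
    Set ℚ :=
  if h : ∃ B, IsExtension β L p.1 p.2 B then h.choose else {0}

noncomputable def levelStep (β : Ordinal.{0}) (L : ∀ γ, γ < β → Set (Set ℚ)) : Set (Set ℚ) :=
  {B | IsNode β L B ∧ (β = 0 → B = {0}) ∧ (β ≠ 0 → ∃ p : Set ℚ × ℚ,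
    (∃ γ, ∃ h : γ < β, p.1 ∈ L γ h) ∧ B = extension β L p)}

/-- The levels of the tree: on level `β > 0` one node is chosen for every node `A` on a lower level
and every rational number above the maximum of `A`. -/
noncomputable def level : Ordinal.{0} → Set (Set ℚ) := WellFounded.fix Ordinal.lt_wf levelStep

theorem level_eq (β : Ordinal.{0}) : level β = levelStep β fun γ _ => level γ :=
  WellFounded.fix_eq _ _ _

theorem isNode_of_mem {β : Ordinal.{0}} {B : Set ℚ} (h : B ∈ level β) :
    IsNode β (fun γ _ => level γ) B := by
  rw [level_eq] at h
  exact h.1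

theorem isGreatest_Iic_inter {B : Set ℚ} {b : ℚ} (hb : b ∈ B) : IsGreatest (B ∩ Iic b) b :=
  ⟨⟨hb, le_refl b⟩, fun _ hc => hc.2⟩

theorem inter_Iic_of_isGreatest {B : Set ℚ} {b : ℚ} (hb : IsGreatest B b) : B ∩ Iic b = B :=
  inter_eq_left.2 fun _ hc => hb.2 hc

theorem exists_extension_of_exists {β : Ordinal.{0}} (h0 : β ≠ 0) {γ : Ordinal.{0}} (hγ : γ < β)
    {A : Set ℚ} (hA : A ∈ level γ) {a q : ℚ} (ha : IsGreatest A a)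
    (h : ∃ B, IsExtension β (fun γ _ => level γ) A q B) :
    ∃ B ∈ level β, IsGreatest B q ∧ B ∩ Iic a = A := by
  have hE : IsExtension β (fun γ _ => level γ) A q
      (extension β (fun γ _ => level γ) (A, q)) := by
    rw [extension, dif_pos h]
    exact h.choose_spec
  refine ⟨extension β (fun γ _ => level γ) (A, q), ?_, hE.2.1, ?_⟩
  · rw [level_eq]
    exact ⟨hE.1, fun h => absurd h h0, fun _ => ⟨(A, q), ⟨γ, hγ, hA⟩, rfl⟩⟩
  · obtain ⟨a', ha', h'⟩ := hE.2.2
    rwa [ha.unique ha']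

theorem countable_Iio_of_lt_omega_one {β : Ordinal.{0}} (hβ : β < Ordinal.omega 1) :
    (Iio β).Countable := by
  rw [← Cardinal.le_aleph0_iff_set_countable, Cardinal.mk_Iio_ordinal, ← Cardinal.lift_aleph0.{1, 0},
    Cardinal.lift_le]
  have := Cardinal.lt_ord.1 (by rwa [Cardinal.ord_aleph] : β < (Cardinal.aleph 1).ord)
  rwa [← Order.lt_succ_iff, Cardinal.succ_aleph0]

/-- The successor step: one rational is added above a node of level δ, and the old maximum becomes
its predecessor. -/
theorem isExtension_insert {δ : Ordinal.{0}} {A A' : Set ℚ} {a a' q : ℚ}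
    (ha : IsGreatest A a) (hA' : A' ∈ level δ) (ha' : IsGreatest A' a')
    (hAA' : A' ∩ Iic a = A) (haq : a < q) (hq : a' < q) :
    IsExtension (Order.succ δ) (fun γ _ => level γ) A q (insert q A') := by
  have hn := isNode_of_mem hA'
  have hlt : ∀ b ∈ A', b < q := fun b hb => (ha'.2 hb).trans_lt hq
  have hin : ∀ b < q, insert q A' ∩ Iic b = A' ∩ Iic b := fun b hb => by
    rw [insert_inter_of_notMem]
    exact not_le.2 hb
  have hgr : IsGreatest (insert q A') q :=
    ⟨mem_insert _ _, fun b hb => hb.elim (fun h => h.le) fun h => (hlt b h).le⟩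
  have hio : insert q A' ∩ Iio q = A' := by
    rw [insert_inter_of_notMem (by simp)]
    exact inter_eq_left.2 hlt
  refine ⟨⟨⟨q, hgr⟩, mem_insert_of_mem _ hn.zero_mem, ?_, ?_, ?_, ?_⟩, hgr, a, ha, ?_⟩
  · rintro b (rfl | hb)
    · exact (hn.nonneg _ ha'.1).trans hq.le
    · exact hn.nonneg b hb
  · intro b hb c hc hbc
    have hbq : b < q := hbc.trans_le (hgr.2 hc)
    have hb' : b ∈ A' := hb.resolve_left hbq.ne
    rw [hin b hbq]
    rcases (ha'.2 hb').eq_or_lt with rfl | hlt'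
    · exact ⟨δ, Order.lt_succ δ, by rwa [inter_Iic_of_isGreatest ha']⟩
    · obtain ⟨ξ, hξ, h⟩ := hn.exists_level b hb' a' ha'.1 hlt'
      exact ⟨ξ, hξ.trans (Order.lt_succ δ), h⟩
  · intro ξ hξ
    rcases (Order.lt_succ_iff.1 hξ).eq_or_lt with rfl | hξ'
    · refine ⟨a', mem_insert_of_mem _ ha'.1, ⟨q, mem_insert _ _, hq⟩, ?_⟩
      rwa [hin a' hq, inter_Iic_of_isGreatest ha']
    · obtain ⟨b, hb, ⟨c, hc, hbc⟩, h⟩ := hn.exists_mem ξ hξ'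
      exact ⟨b, mem_insert_of_mem _ hb, ⟨c, mem_insert_of_mem _ hc, hbc⟩,
        by rwa [hin b (hlt b hb)]⟩
  · intro _ q' hq'
    rw [hq'.unique hgr, hio]
    exact Or.inl ⟨a', ha'⟩
  · rw [hin a haq, hAA']

theorem isLUB_of_forall_sub_lt {S : Set ℚ} {q : ℚ} (h₁ : ∀ s ∈ S, s ≤ q)
    (h₂ : ∀ ε > 0, ∃ s ∈ S, q - s < ε) : IsLUB S q := by
  refine ⟨h₁, fun c hc => ?_⟩
  by_contra hlt
  obtain ⟨s, hs, hs'⟩ := h₂ (q - c) (by linarith)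
  linarith [hc hs]

/-- The limit step: end extensions on cofinal levels, with maxima converging to q, are united and
closed off by q. Every initial segment is already one of some A n. -/
theorem isExtension_iUnion {β : Ordinal.{0}} {A : ℕ → Set ℚ} {γ : ℕ → Ordinal.{0}} {a : ℕ → ℚ}
    {q : ℚ} (hA : ∀ n, A n ∈ level (γ n)) (ha : ∀ n, IsGreatest (A n) (a n))
    (hAA : ∀ n, A (n + 1) ∩ Iic (a n) = A n) (haa : ∀ n, a n < a (n + 1)) (haq : ∀ n, a n < q)
    (hlim : ∀ ε > 0, ∃ n, q - a n < ε) (hγ : ∀ n, γ n < β) (hcof : ∀ ξ < β, ∃ n, ξ < γ n) :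
    IsExtension β (fun γ _ => level γ) (A 0) q (insert q (⋃ n, A n)) := by
  have hamono : StrictMono a := strictMono_nat_of_lt_succ haa
  have hsub : ∀ m n, m ≤ n → A n ∩ Iic (a m) = A m := by
    intro m n hmn
    induction n, hmn using Nat.le_induction with
    | base => exact inter_Iic_of_isGreatest (ha m)
    | succ n hmn ih =>
      rw [← ih]
      conv_rhs => rw [← hAA n, inter_assoc, Iic_inter_Iic,
        min_eq_right (hamono.monotone hmn)]
  have hU : ∀ n b, b ≤ a n → (⋃ n, A n) ∩ Iic b = A n ∩ Iic b := by
    intro n b hb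
    ext x
    simp only [mem_inter_iff, mem_iUnion, mem_Iic]
    refine ⟨fun ⟨⟨m, hm⟩, hx⟩ => ⟨?_, hx⟩, fun ⟨h, hx⟩ => ⟨⟨n, h⟩, hx⟩⟩
    rcases le_total m n with hmn | hmn
    · rw [← hsub m n hmn] at hm
      exact hm.1
    · rw [← hsub n m hmn]
      exact ⟨hm, hx.trans hb⟩
  have hlt : ∀ b ∈ ⋃ n, A n, b < q := by
    intro b hb
    obtain ⟨n, hn⟩ := mem_iUnion.1 hb
    exact ((ha n).2 hn).trans_lt (haq n)
  have hin : ∀ n b, b ≤ a n → insert q (⋃ n, A n) ∩ Iic b = A n ∩ Iic b := fun n b hb => by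
    rw [insert_inter_of_notMem (show q ∉ Iic b from not_le.2 (hb.trans_lt (haq n))), hU n b hb]
  have hgr : IsGreatest (insert q (⋃ n, A n)) q :=
    ⟨mem_insert _ _, fun b hb => hb.elim (fun h => h.le) fun h => (hlt b h).le⟩
  have hio : insert q (⋃ n, A n) ∩ Iio q = ⋃ n, A n := by
    rw [insert_inter_of_notMem (by simp)]
    exact inter_eq_left.2 hlt
  refine ⟨⟨⟨q, hgr⟩, ?_, ?_, ?_, ?_, ?_⟩, hgr, a 0, ha 0, ?_⟩
  · exact mem_insert_of_mem _ (mem_iUnion.2 ⟨0, (isNode_of_mem (hA 0)).zero_mem⟩)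
  · rintro b (rfl | hb)
    · exact ((isNode_of_mem (hA 0)).nonneg _ (ha 0).1).trans (haq 0).le
    · obtain ⟨n, hn⟩ := mem_iUnion.1 hb
      exact (isNode_of_mem (hA n)).nonneg b hn
  · intro b hb c hc hbc
    have hbq : b < q := hbc.trans_le (hgr.2 hc)
    obtain ⟨n, hn⟩ := mem_iUnion.1 (hb.resolve_left hbq.ne)
    have hle := (ha n).2 hn
    have hb' : b ∈ A (n + 1) := by
      rw [← hAA n] at hn
      exact hn.1
    obtain ⟨ξ, hξ, h⟩ := (isNode_of_mem (hA (n + 1))).exists_level b hb' _ (ha (n + 1)).1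
      (hle.trans_lt (haa n))
    exact ⟨ξ, hξ.trans (hγ _), by rwa [hin (n + 1) b (hle.trans (haa n).le)]⟩
  · intro ξ hξ
    obtain ⟨n, hn⟩ := hcof ξ hξ
    obtain ⟨b, hb, ⟨c, hc, hbc⟩, h⟩ := (isNode_of_mem (hA n)).exists_mem ξ hn
    have hsubset : A n ⊆ insert q (⋃ n, A n) := (subset_iUnion A n).trans (subset_insert _ _)
    exact ⟨b, hsubset hb, ⟨c, hsubset hc, hbc⟩, by rwa [hin n b ((ha n).2 hb)]⟩
  · intro _ q' hq'
    rw [hq'.unique hgr, hio]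
    refine Or.inr (isLUB_of_forall_sub_lt (fun s hs => (hlt s hs).le) fun ε hε => ?_)
    obtain ⟨n, hn⟩ := hlim ε hε
    exact ⟨a n, mem_iUnion.2 ⟨n, (ha n).1⟩, hn⟩
  · rw [hin 0 _ le_rfl, inter_Iic_of_isGreatest (ha 0)]

/-- Allowing every maximum q > a is what keeps the induction going: there is always room below q for
the intermediate nodes. -/
theorem exists_extension {β : Ordinal.{0}} (hβ : β < Ordinal.omega 1) {γ : Ordinal.{0}}
    (hγ : γ < β) {A : Set ℚ} (hA : A ∈ level γ) {a q : ℚ} (ha : IsGreatest A a) (haq : a < q) :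
    ∃ B ∈ level β, IsGreatest B q ∧ B ∩ Iic a = A := by
  induction β using WellFoundedLT.induction generalizing γ A a q with
  | ind β ih =>
    have h0 : β ≠ 0 := (zero_le.trans_lt hγ).ne'
    refine exists_extension_of_exists h0 hγ hA ha ?_
    rcases Ordinal.zero_or_succ_or_isSuccLimit β with h | ⟨δ, rfl⟩ | hlim
    · exact absurd h h0
    · rcases (Order.lt_succ_iff.1 hγ).eq_or_lt with rfl | hγδ
      · exact ⟨_, isExtension_insert ha hA ha (inter_Iic_of_isGreatest ha) haq haq⟩
      · obtain ⟨m, hm1, hm2⟩ := exists_between haq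
        obtain ⟨A', hA', hm, hAA'⟩ := ih δ (Order.lt_succ δ) ((Order.lt_succ δ).trans hβ) hγδ hA
          ha hm1
        exact ⟨_, isExtension_insert ha hA' hm hAA' haq hm2⟩
    · obtain ⟨e, he⟩ := (countable_Iio_of_lt_omega_one hβ).exists_eq_range ⟨γ, hγ⟩
      have heβ : ∀ n, e n < β := fun n => by
        have : e n ∈ Iio β := he ▸ mem_range_self n
        exact this
      let P := {p : Ordinal.{0} × Set ℚ × ℚ // p.1 < β ∧ p.2.1 ∈ level p.1 ∧
        IsGreatest p.2.1 p.2.2 ∧ p.2.2 < q}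
      have step : ∀ (n : ℕ) (p : P), ∃ p' : P, e n < p'.1.1 ∧
          p'.1.2.1 ∩ Iic p.1.2.2 = p.1.2.1 ∧ p'.1.2.2 = (p.1.2.2 + q) / 2 := by
        rintro n ⟨⟨ξ, C, c⟩, hξ, hC, hc, hcq⟩
        simp only at hξ hC hc hcq
        -- Passing e n at step n makes the levels cofinal in β; halving the distance to q makes the
        -- maxima converge to q.
        have hs : Order.succ (max ξ (e n)) < β := hlim.succ_lt (max_lt hξ (heβ n))
        obtain ⟨C', hC', hc', hCC'⟩ := ih _ hs (hs.trans hβ)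
          (Order.lt_succ_of_le (le_max_left ξ (e n))) hC hc
          (show c < (c + q) / 2 by linarith)
        exact ⟨⟨⟨_, C', _⟩, hs, hC', hc', by simp only; linarith⟩,
          Order.lt_succ_of_le (le_max_right ξ (e n)), hCC', rfl⟩
      choose next hn1 hn2 hn3 using step
      let s : ℕ → P := fun n => Nat.rec ⟨(γ, A, a), hγ, hA, ha, haq⟩ next n
      have hs : ∀ n, s (n + 1) = next n (s n) := fun n => rfl
      have hdist : ∀ n, q - (s n).1.2.2 = (q - a) * (1 / 2) ^ n := by
        intro n
        induction n with
        | zero => show q - a = _; simp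
        | succ n ihn =>
          rw [hs, hn3, pow_succ, ← mul_assoc, ← ihn]
          ring
      refine ⟨_, isExtension_iUnion (A := fun n => (s n).1.2.1) (γ := fun n => (s n).1.1)
        (a := fun n => (s n).1.2.2) (q := q) (fun n => (s n).2.2.1) (fun n => (s n).2.2.2.1)
        (fun n => ?_) (fun n => ?_) (fun n => (s n).2.2.2.2) (fun ε hε => ?_)
        (fun n => (s n).2.1) (fun ξ hξ => ?_)⟩
      · exact hn2 n (s n)
      · show (s n).1.2.2 < (s (n + 1)).1.2.2
        rw [hs, hn3]
        linarith [(s n).2.2.2.2]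
      · have hpos : 0 < q - a := by linarith
        obtain ⟨n, hn⟩ := exists_pow_lt_of_lt_one (div_pos hε hpos)
          (by norm_num : (1 / 2 : ℚ) < 1)
        refine ⟨n, ?_⟩
        rw [hdist, mul_comm]
        exact (lt_div_iff₀ hpos).1 hn
      · have : ξ ∈ range e := he ▸ hξ
        obtain ⟨n, rfl⟩ := this
        exact ⟨n + 1, by show e n < (s (n + 1)).1.1; rw [hs]; exact hn1 n (s n)⟩

theorem mem_level_zero : ({0} : Set ℚ) ∈ level 0 := by
  rw [level_eq]
  have hg : IsGreatest ({0} : Set ℚ) 0 := isGreatest_singleton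
  refine ⟨⟨⟨0, hg⟩, rfl, ?_, ?_, ?_, fun h => absurd rfl h⟩, fun _ => rfl, fun h => absurd rfl h⟩
  · rintro b rfl
    exact le_rfl
  · rintro b rfl c rfl h
    exact absurd h (lt_irrefl _)
  · exact fun γ h => absurd h (not_lt.2 zero_le)

theorem eq_of_mem_level_zero {B : Set ℚ} (h : B ∈ level 0) : B = {0} := by
  rw [level_eq] at h
  exact h.2.1 rfl

theorem level_nonempty {β : Ordinal.{0}} (hβ : β < Ordinal.omega 1) : (level β).Nonempty := by
  rcases eq_or_ne β 0 with rfl | h0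
  · exact ⟨_, mem_level_zero⟩
  · obtain ⟨B, hB, -⟩ := exists_extension hβ (pos_iff_ne_zero.2 h0) mem_level_zero
      isGreatest_singleton (zero_lt_one (α := ℚ))
    exact ⟨B, hB⟩

theorem countable_level {β : Ordinal.{0}} (hβ : β < Ordinal.omega 1) : (level β).Countable := by
  induction β using WellFoundedLT.induction with
  | ind β ih =>
    rcases eq_or_ne β 0 with rfl | h0
    · exact (countable_singleton {0}).mono fun B hB => eq_of_mem_level_zero hB
    · have h1 : (⋃ γ ∈ Iio β, level γ).Countable :=
        (countable_Iio_of_lt_omega_one hβ).biUnion fun γ hγ => ih γ hγ (lt_trans hγ hβ)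
      refine ((h1.prod (countable_univ (α := ℚ))).image
        (extension β fun γ _ => level γ)).mono fun B hB => ?_
      rw [level_eq] at hB
      obtain ⟨p, ⟨γ, hγ, hp⟩, rfl⟩ := hB.2.2 h0
      exact ⟨p, ⟨mem_biUnion hγ hp, trivial⟩, rfl⟩

/-- If B were on levels γ < β, it would have a proper initial segment on level γ, which would also
be on a level below γ; induction on γ excludes this. -/
theorem notMem_level_of_lt {γ β : Ordinal.{0}} (h : γ < β) {B : Set ℚ} (hB : B ∈ level γ) :
    B ∉ level β := by
  induction γ using WellFoundedLT.induction generalizing β B with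
  | ind γ ih =>
    intro hB'
    obtain ⟨b, hb, ⟨c, hc, hbc⟩, hb'⟩ := (isNode_of_mem hB').exists_mem γ h
    obtain ⟨ξ, hξ, hξ'⟩ := (isNode_of_mem hB).exists_level b hb c hc hbc
    exact ih ξ hξ hξ hξ' hb'

theorem level_unique {γ β : Ordinal.{0}} {B : Set ℚ} (h₁ : B ∈ level γ) (h₂ : B ∈ level β) :
    γ = β := by
  rcases lt_trichotomy γ β with h | h | h
  · exact absurd h₂ (notMem_level_of_lt h h₁)
  · exact h
  · exact absurd h₁ (notMem_level_of_lt h h₂)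

end AronszajnTree

/-- A tree of height `ω₁` with countable levels, none of whose nodes has uncountably many
predecessors; the order is end extension of sets of rational numbers. -/
@[ext]
structure AronszajnTree : Type where
  carrier : Set ℚ
  exists_mem_level : ∃ β < Ordinal.omega.{0} 1, carrier ∈ AronszajnTree.level β

namespace AronszajnTree

noncomputable def lvl (B : AronszajnTree) : Ordinal.{0} := B.exists_mem_level.choose

theorem lvl_lt (B : AronszajnTree) : lvl B < Ordinal.omega 1 := B.exists_mem_level.choose_spec.1

theorem mem_level (B : AronszajnTree) : B.carrier ∈ level (lvl B) :=
  B.exists_mem_level.choose_spec.2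

theorem isNode (B : AronszajnTree) : IsNode (lvl B) (fun γ _ => level γ) B.carrier :=
  isNode_of_mem B.mem_level

theorem lvl_eq {B : AronszajnTree} {β : Ordinal.{0}} (h : B.carrier ∈ level β) : lvl B = β :=
  level_unique B.mem_level h

/-- The maximum of the set of rational numbers. -/
noncomputable def sup (B : AronszajnTree) : ℚ := B.isNode.exists_isGreatest.choose

theorem isGreatest_sup (B : AronszajnTree) : IsGreatest B.carrier B.sup :=
  B.isNode.exists_isGreatest.choose_spec

theorem inter_Iic_sup (B : AronszajnTree) : B.carrier ∩ Iic B.sup = B.carrier :=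
  inter_Iic_of_isGreatest B.isGreatest_sup

instance : PartialOrder AronszajnTree where
  le B C := B.sup ∈ C.carrier ∧ C.carrier ∩ Iic B.sup = B.carrier
  le_refl B := ⟨B.isGreatest_sup.1, B.inter_Iic_sup⟩
  le_trans A B C hAB hBC := by
    have h := hBC.2 ▸ hAB.1
    refine ⟨h.1, ?_⟩
    have h2 := hAB.2
    rwa [← hBC.2, inter_assoc, Iic_inter_Iic, min_eq_right h.2] at h2
  le_antisymm A B hAB hBA := by
    have h : A.sup = B.sup :=
      le_antisymm (B.isGreatest_sup.2 hAB.1) (A.isGreatest_sup.2 hBA.1)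
    ext1
    rw [← hAB.2, h, B.inter_Iic_sup]

theorem le_iff {B C : AronszajnTree} :
    B ≤ C ↔ B.sup ∈ C.carrier ∧ C.carrier ∩ Iic B.sup = B.carrier := Iff.rfl

theorem sup_lt_sup {B C : AronszajnTree} (h : B < C) : B.sup < C.sup := by
  refine lt_of_le_of_ne (C.isGreatest_sup.2 h.le.1) fun he => h.ne ?_
  ext1
  rw [← h.le.2, he, C.inter_Iic_sup]

theorem le_of_sup_le {B C D : AronszajnTree} (hB : B ≤ D) (hC : C ≤ D) (h : B.sup ≤ C.sup) :
    B ≤ C := by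
  refine ⟨hC.2 ▸ ⟨hB.1, h⟩, ?_⟩
  rw [← hC.2, inter_assoc, Iic_inter_Iic, min_eq_right h, hB.2]

theorem lvl_lt_lvl {B C : AronszajnTree} (h : B < C) : lvl B < lvl C := by
  obtain ⟨γ, hγ, h'⟩ := C.isNode.exists_level _ h.le.1 _ C.isGreatest_sup.1 (sup_lt_sup h)
  rw [h.le.2] at h'
  rwa [lvl_eq h']

theorem inter_Iic_mem_level {C : AronszajnTree} {b : ℚ} (hb : b ∈ C.carrier) :
    ∃ β < Ordinal.omega.{0} 1, C.carrier ∩ Iic b ∈ level β := by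
  rcases (C.isGreatest_sup.2 hb).eq_or_lt with rfl | h
  · exact ⟨lvl C, C.lvl_lt, by rw [C.inter_Iic_sup]; exact C.mem_level⟩
  · obtain ⟨γ, hγ, h'⟩ := C.isNode.exists_level b hb _ C.isGreatest_sup.1 h
    exact ⟨γ, hγ.trans C.lvl_lt, h'⟩

/-- The initial segment of `C` with maximum `b`. -/
def restrict (C : AronszajnTree) (b : ℚ) (hb : b ∈ C.carrier) : AronszajnTree :=
  ⟨C.carrier ∩ Iic b, inter_Iic_mem_level hb⟩

theorem sup_restrict {C : AronszajnTree} {b : ℚ} (hb : b ∈ C.carrier) :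
    (C.restrict b hb).sup = b :=
  (C.restrict b hb).isGreatest_sup.unique (isGreatest_Iic_inter hb)

theorem restrict_le {C : AronszajnTree} {b : ℚ} (hb : b ∈ C.carrier) : C.restrict b hb ≤ C := by
  rw [le_iff, sup_restrict]
  exact ⟨hb, rfl⟩

theorem restrict_lt {C : AronszajnTree} {b : ℚ} (hb : b ∈ C.carrier) (h : b < C.sup) :
    C.restrict b hb < C := by
  refine lt_of_le_of_ne (restrict_le hb) fun he => h.ne ?_
  rw [← he, sup_restrict]

theorem exists_minimal_not_le {h h' : AronszajnTree} (hh : ¬ h ≤ h') :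
    ∃ k ≤ h, ¬ k ≤ h' ∧ ∀ i < k, i ≤ h' := by
  induction hα : lvl h using WellFoundedLT.induction generalizing h with
  | ind α ih =>
    by_cases hmin : ∀ i < h, i ≤ h'
    · exact ⟨h, le_rfl, hh, hmin⟩
    · push Not at hmin
      obtain ⟨i, hi, hi'⟩ := hmin
      obtain ⟨k, hk, h2⟩ := ih (lvl i) (hα ▸ lvl_lt_lvl hi) hi' rfl
      exact ⟨k, hk.trans hi.le, h2⟩

instance : OrderBot AronszajnTree where
  bot := ⟨{0}, 0, Ordinal.omega_pos 1, mem_level_zero⟩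
  bot_le C := by
    have h : (⟨{0}, 0, Ordinal.omega_pos 1, mem_level_zero⟩ : AronszajnTree).sup = 0 :=
      (isGreatest_sup _).unique isGreatest_singleton
    rw [le_iff, h]
    refine ⟨C.isNode.zero_mem, ?_⟩
    ext b
    constructor
    · rintro ⟨hb, hb'⟩
      exact le_antisymm hb' (C.isNode.nonneg b hb)
    · rintro rfl
      exact ⟨C.isNode.zero_mem, le_refl (0 : ℚ)⟩

theorem carrier_bot : (⊥ : AronszajnTree).carrier = {0} := rfl

theorem sup_bot : (⊥ : AronszajnTree).sup = 0 :=
  (isGreatest_sup _).unique isGreatest_singleton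

theorem lvl_ne_zero {C : AronszajnTree} (h : C ≠ ⊥) : lvl C ≠ 0 := fun h0 => h <| by
  ext1
  exact eq_of_mem_level_zero (h0 ▸ C.mem_level)

/-! ### Heights and directions on the Aronszajn tree -/

/-- Summable positive weights of the rational numbers. -/
noncomputable def weight : ℚ → ℝ := (posSumOfEncodable zero_lt_one ℚ).1

theorem weight_pos (q : ℚ) : 0 < weight q := (posSumOfEncodable zero_lt_one ℚ).2.1 q

theorem summable_weight : Summable weight :=
  let ⟨_, h, _⟩ := (posSumOfEncodable zero_lt_one ℚ).2.2
  h.summable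

theorem tsum_weight_le_one : ∑' q, weight q ≤ 1 :=
  let ⟨_, h, h1⟩ := (posSumOfEncodable zero_lt_one ℚ).2.2
  h.tsum_eq.trans_le h1

noncomputable def weightSum (S : Set ℚ) : ℝ := ∑' q, S.indicator weight q

theorem summable_indicator_weight (S : Set ℚ) : Summable (S.indicator weight) :=
  summable_weight.indicator S

theorem weightSum_mono {S S' : Set ℚ} (h : S ⊆ S') : weightSum S ≤ weightSum S' :=
  (summable_indicator_weight S).tsum_le_tsum
    (fun q => indicator_le_indicator_of_subset h (fun q => (weight_pos q).le) q)
    (summable_indicator_weight S')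

theorem weightSum_le_one (S : Set ℚ) : weightSum S ≤ 1 :=
  (weightSum_mono (subset_univ S)).trans (by
    rw [weightSum, indicator_univ]
    exact tsum_weight_le_one)

theorem weightSum_insert {S : Set ℚ} {q : ℚ} (h : q ∉ S) :
    weightSum (insert q S) = weightSum S + weight q := by
  have h1 : weightSum {q} = weight q := by
    rw [weightSum, tsum_eq_single q fun b hb => indicator_of_notMem (by simpa using hb) _]
    exact indicator_of_mem rfl _
  rw [insert_eq, ← h1, weightSum, indicator_union_of_disjoint (by simpa using h), add_comm,
    weightSum, weightSum]
  exact (summable_indicator_weight {q}).tsum_add (summable_indicator_weight S)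

/-- A finite partial sum already exceeds x; a is the largest element of S that occurs in it. -/
theorem exists_mem_lt_weightSum_inter_Iic {S : Set ℚ} {x : ℝ} (h0 : 0 ≤ x)
    (hx : x < weightSum S) : ∃ a ∈ S, x < weightSum (S ∩ Iic a) := by
  classical
  obtain ⟨F, hF⟩ :=
    ((summable_indicator_weight S).hasSum.eventually_const_lt hx).exists
  have hne : (F.filter (· ∈ S)).Nonempty := by
    by_contra hne
    rw [Finset.not_nonempty_iff_eq_empty, Finset.filter_eq_empty_iff] at hne
    rw [Finset.sum_eq_zero fun q hq => indicator_of_notMem (hne hq) _] at hF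
    linarith
  have hmem := Finset.max'_mem _ hne
  refine ⟨_, (Finset.mem_filter.1 hmem).2, hF.trans_le ?_⟩
  refine le_trans (Finset.sum_le_sum fun q hq => ?_)
    ((summable_indicator_weight _).sum_le_tsum F
      fun q _ => indicator_nonneg (fun q _ => (weight_pos q).le) q)
  by_cases hq' : q ∈ S
  · rw [indicator_of_mem hq', indicator_of_mem]
    exact ⟨hq', Finset.le_max' _ _ (Finset.mem_filter.2 ⟨hq, hq'⟩)⟩
  · rw [indicator_of_notMem hq']
    exact indicator_nonneg (fun q _ => (weight_pos q).le) q

-- The next element records the first step from B towards C, so it does not change further up the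
-- branch. The default 0 serves `dir_self`.
open Classical in
noncomputable def nextCode (B C : AronszajnTree) : ℤ :=
  if h : ∃ n, IsLeast (C.carrier ∩ Ioi B.sup) n then (Encodable.encode h.choose : ℤ) else 0

theorem nextCode_of_isLeast {B C : AronszajnTree} {n : ℚ}
    (h : IsLeast (C.carrier ∩ Ioi B.sup) n) : nextCode B C = Encodable.encode n := by
  have h' : ∃ n, IsLeast (C.carrier ∩ Ioi B.sup) n := ⟨n, h⟩
  rw [nextCode, dif_pos h', h'.choose_spec.unique h]

theorem nextCode_of_not_exists {B C : AronszajnTree}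
    (h : ¬ ∃ n, IsLeast (C.carrier ∩ Ioi B.sup) n) : nextCode B C = 0 := by
  rw [nextCode, dif_neg h]

theorem isLeast_inter_Ioi_iff {j i h : AronszajnTree} (hji : j < i) (hih : i ≤ h) {n : ℚ} :
    IsLeast (h.carrier ∩ Ioi j.sup) n ↔ IsLeast (i.carrier ∩ Ioi j.sup) n := by
  have hsup := sup_lt_sup hji
  rw [← hih.2]
  constructor
  · rintro ⟨⟨h1, h2⟩, h3⟩
    exact ⟨⟨⟨h1, h3 ⟨hih.1, hsup⟩⟩, h2⟩, fun c hc => h3 ⟨hc.1.1, hc.2⟩⟩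
  · rintro ⟨⟨⟨h1, h1'⟩, h2⟩, h3⟩
    refine ⟨⟨h1, h2⟩, fun c hc => ?_⟩
    rcases le_total c i.sup with hle | hle
    · exact h3 ⟨⟨hc.1, hle⟩, hc.2⟩
    · exact le_trans h1' hle

theorem nextCode_eq {j i h : AronszajnTree} (hji : j < i) (hih : i ≤ h) :
    nextCode j h = nextCode j i := by
  by_cases hn : ∃ n, IsLeast (i.carrier ∩ Ioi j.sup) n
  · obtain ⟨n, hn⟩ := hn
    rw [nextCode_of_isLeast hn, nextCode_of_isLeast ((isLeast_inter_Ioi_iff hji hih).2 hn)]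
  · rw [nextCode_of_not_exists hn, nextCode_of_not_exists]
    rintro ⟨n, h'⟩
    exact hn ⟨n, (isLeast_inter_Ioi_iff hji hih).1 h'⟩

theorem insert_inter_Iio_sup (C : AronszajnTree) :
    insert C.sup (C.carrier ∩ Iio C.sup) = C.carrier := by
  ext b
  constructor
  · rintro (rfl | hb)
    · exact C.isGreatest_sup.1
    · exact hb.1
  · intro hb
    rcases (C.isGreatest_sup.2 hb).eq_or_lt with h | h
    · exact Or.inl h
    · exact Or.inr ⟨hb, h⟩

theorem weightSum_carrier (C : AronszajnTree) :
    weightSum (C.carrier ∩ Iio C.sup) + weight C.sup = weightSum C.carrier := by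
  rw [← weightSum_insert (fun h => lt_irrefl C.sup h.2), insert_inter_Iio_sup]

/-- A proper initial segment of k is below both h and h'. Compared with k' inside h', it cannot be
at or above k', since k' is not below h. -/
theorem inter_Iio_sup_subset {h h' k k' : AronszajnTree} (hk : k ≤ h) (hk₂ : ∀ i < k, i ≤ h')
    (hk' : k' ≤ h') (hk₁' : ¬ k' ≤ h) : k.carrier ∩ Iio k.sup ⊆ k'.carrier ∩ Iio k'.sup := by
  rintro a ⟨ha, ha'⟩
  have hi := restrict_lt ha ha'
  have hik : k.restrict a ha ≤ h := hi.le.trans hk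
  have hlt : k.restrict a ha < k' := by
    rcases le_total (k.restrict a ha).sup k'.sup with hs | hs
    · exact lt_of_le_of_ne (le_of_sup_le (hk₂ _ hi) hk' hs) fun he => hk₁' (he ▸ hik)
    · exact absurd ((le_of_sup_le hk' (hk₂ _ hi) hs).trans hik) hk₁'
  have h1 := hlt.le.1
  have h2 := sup_lt_sup hlt
  rw [sup_restrict] at h1 h2
  exact ⟨h1, h2⟩

theorem isLeast_Ioi_of_isGreatest {C : AronszajnTree} {a : ℚ}
    (h : IsGreatest (C.carrier ∩ Iio C.sup) a) : IsLeast (C.carrier ∩ Ioi a) C.sup := by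
  refine ⟨⟨C.isGreatest_sup.1, h.1.2⟩, fun c hc => ?_⟩
  by_contra hlt
  exact absurd (h.2 ⟨hc.1, not_le.1 hlt⟩) (not_le.2 hc.2)

/-- The first nodes k and k' where the branches differ have the same predecessors but different
maxima. If there is a last predecessor, these maxima are the next elements above it. -/
theorem exists_nextCode_ne {h h' : AronszajnTree} (h₁ : ¬ h ≤ h') (h₂ : ¬ h' ≤ h) :
    ∃ j, j < h ∧ j < h' ∧ nextCode j h ≠ nextCode j h' := by
  obtain ⟨k, hk, hk1, hk2⟩ := exists_minimal_not_le h₁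
  obtain ⟨k', hk', hk1', hk2'⟩ := exists_minimal_not_le h₂
  have hD : k.carrier ∩ Iio k.sup = k'.carrier ∩ Iio k'.sup :=
    (inter_Iio_sup_subset hk hk2 hk' hk1').antisymm (inter_Iio_sup_subset hk' hk2' hk hk1)
  have hne : k.sup ≠ k'.sup := fun he => by
    have : k = k' := by
      ext1
      rw [← insert_inter_Iio_sup k, ← insert_inter_Iio_sup k', hD, he]
    exact hk1 (this ▸ hk')
  have hbot : k ≠ ⊥ := fun he => hk1 (he ▸ bot_le)
  have hbot' : k' ≠ ⊥ := fun he => hk1' (he ▸ bot_le)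
  by_cases hmax : ∃ a, IsGreatest (k.carrier ∩ Iio k.sup) a
  · obtain ⟨a, ha⟩ := hmax
    have hj := restrict_lt ha.1.1 ha.1.2
    have hjs := sup_restrict ha.1.1
    set j := k.restrict a ha.1.1 with hj_def
    have hjk' : j < k' := by
      have hs : j.sup < k'.sup := hjs ▸ (hD ▸ ha.1 : a ∈ k'.carrier ∩ Iio k'.sup).2
      exact lt_of_le_of_ne (le_of_sup_le (hk2 _ hj) hk' hs.le) fun he => hs.ne (he ▸ rfl)
    refine ⟨j, hj.trans_le hk, hjk'.trans_le hk', ?_⟩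
    rw [nextCode_eq hj hk, nextCode_eq hjk' hk',
      nextCode_of_isLeast (hjs ▸ isLeast_Ioi_of_isGreatest ha),
      nextCode_of_isLeast (hjs ▸ isLeast_Ioi_of_isGreatest (hD ▸ ha))]
    exact_mod_cast fun he => hne (Encodable.encode_injective he)
  -- Without a last predecessor both maxima are suprema of the same set and hence equal; the clause
  -- `isLUB` of `IsNode` excludes such branching at limits.
  · have h1 := (k.isNode.isLUB (lvl_ne_zero hbot) _ k.isGreatest_sup).resolve_left hmax
    have h2 := (k'.isNode.isLUB (lvl_ne_zero hbot') _ k'.isGreatest_sup).resolve_left (hD ▸ hmax)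
    exact absurd (h1.unique (hD ▸ h2)) hne

/-- If some predecessor starts above x, descend to it. Otherwise take an initial segment of weight
greater than x: it ends above x and starts at or below x. -/
theorem exists_lt_weightSum {h : AronszajnTree} {x : ℝ} (h0 : 0 ≤ x)
    (hx : x < weightSum (h.carrier ∩ Iio h.sup)) : ∃ k < h,
      weightSum (k.carrier ∩ Iio k.sup) ≤ x ∧
        x < weightSum (k.carrier ∩ Iio k.sup) + weight k.sup := by
  induction hα : lvl h using WellFoundedLT.induction generalizing h with
  | ind α ih =>
    by_cases hmin : ∀ i < h, weightSum (i.carrier ∩ Iio i.sup) ≤ x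
    · obtain ⟨a, ha, hlt⟩ := exists_mem_lt_weightSum_inter_Iic h0 hx
      have hj := restrict_lt ha.1 ha.2
      refine ⟨_, hj, hmin _ hj, hlt.trans_le ?_⟩
      rw [weightSum_carrier]
      exact weightSum_mono fun b hb => ⟨hb.1.1, hb.2⟩
    · push Not at hmin
      obtain ⟨i, hi, hi'⟩ := hmin
      obtain ⟨k, hk, h2⟩ := ih (lvl i) (hα ▸ lvl_lt_lvl hi) hi' rfl
      exact ⟨k, hk.trans hi, h2⟩

noncomputable instance : RoadTree AronszajnTree where
  ht B := weightSum (B.carrier ∩ Iio B.sup)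
  len B := weight B.sup
  dir := nextCode
  le_or_le {j k h} hj hk := (le_total j.sup k.sup).imp (le_of_sup_le hj hk) (le_of_sup_le hk hj)
  len_pos B := weight_pos _
  len_le_one B := by
    have h : weightSum {B.sup} = weight B.sup := by
      rw [← insert_empty_eq, weightSum_insert (notMem_empty _)]
      simp [weightSum]
    exact h ▸ weightSum_le_one _
  ht_bot := by
    rw [carrier_bot, sup_bot]
    simp [weightSum]
  ht_add_len_le {j k} h := by
    rw [weightSum_carrier]
    refine weightSum_mono fun b hb => ⟨(h.le.2.symm ▸ hb : b ∈ k.carrier ∩ Iic j.sup).1, ?_⟩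
    exact (j.isGreatest_sup.2 hb).trans_lt (sup_lt_sup h)
  exists_bound := ⟨1, fun k => by
    rw [weightSum_carrier]
    exact weightSum_le_one _⟩
  exists_lt_tile h0 hx := exists_lt_weightSum h0 hx
  dir_self h := nextCode_of_not_exists fun ⟨n, hn⟩ =>
    absurd (h.isGreatest_sup.2 hn.1.1) (not_le.2 hn.1.2)
  dir_eq := nextCode_eq
  exists_dir_ne := exists_nextCode_ne

theorem lvl_mono {j k : AronszajnTree} (h : j ≤ k) : lvl j ≤ lvl k := by
  rcases h.eq_or_lt with rfl | h
  · exact le_rfl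
  · exact (lvl_lt_lvl h).le

/-- A node of level greater than α has a predecessor exactly on level α. -/
theorem lvl_le_of_forall_lt {k : AronszajnTree} {α : Ordinal.{0}} (h : ∀ j < k, lvl j < α) :
    lvl k ≤ α := by
  by_contra! hlt
  obtain ⟨b, hb, ⟨c, hc, hbc⟩, hb'⟩ := k.isNode.exists_mem α hlt
  have hj := h _ (restrict_lt hb (hbc.trans_le (k.isGreatest_sup.2 hc)))
  rw [lvl_eq (B := k.restrict b hb) hb'] at hj
  exact lt_irrefl _ hj

theorem carrier_injective : Function.Injective carrier := fun _ _ => AronszajnTree.ext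

theorem countable_setOf_lvl_lt {α : Ordinal.{0}} (hα : α < Ordinal.omega 1) :
    {k : AronszajnTree | lvl k < α}.Countable := by
  refine MapsTo.countable_of_injOn (f := carrier) (t := ⋃ γ ∈ Iio α, level γ)
    (fun k hk => mem_biUnion (show lvl k ∈ Iio α from hk) k.mem_level)
    carrier_injective.injOn ?_
  exact (countable_Iio_of_lt_omega_one hα).biUnion fun γ hγ => countable_level (lt_trans hγ hα)

/-- Along a chain of predecessors the maxima are distinct rationals. -/
theorem countable_Iic (h : AronszajnTree) : (Iic h).Countable := by
  refine MapsTo.countable_of_injOn (f := sup) (t := univ) (fun _ _ => trivial) ?_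
    countable_univ
  intro j hj k hk he
  exact (le_of_sup_le hj hk he.le).antisymm (le_of_sup_le hk hj he.ge)

theorem not_countable_univ : ¬ (univ : Set AronszajnTree).Countable := by
  intro h
  have hr : Iio (Ordinal.omega.{0} 1) ⊆ lvl '' univ := fun β hβ => by
    obtain ⟨B, hB⟩ := level_nonempty hβ
    exact ⟨⟨B, β, hβ, hB⟩, trivial, lvl_eq (B := ⟨B, β, hβ, hB⟩) hB⟩
  have h' := (h.image lvl).mono hr
  rw [← Cardinal.le_aleph0_iff_set_countable, Cardinal.mk_Iio_ordinal,
    ← Cardinal.lift_aleph0.{1, 0}, Cardinal.lift_le, ← Cardinal.ord_aleph, Cardinal.card_ord]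
    at h'
  exact absurd h' (not_le.2 Cardinal.aleph0_lt_aleph_one)

end AronszajnTree

/-! ### The tree of copies and its translations -/

/-- The tree with a root `base` having countably many successors `fst i`, on each of which stand
copies of the tree `N` indexed by the integers. -/
inductive CopyTree (N : Type) : Type
  | base
  | fst (i : ℕ)
  | copy (i : ℕ) (j : ℤ) (t : N)

namespace CopyTree

section

variable {N : Type} [PartialOrder N]

protected def le : CopyTree N → CopyTree N → Prop
  | base, _ => True
  | fst i, fst i' => i = i'
  | fst i, copy i' _ _ => i = i'
  | copy i j s, copy i' j' t => i = i' ∧ j = j' ∧ s ≤ t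
  | _, _ => False

instance : LE (CopyTree N) := ⟨CopyTree.le⟩

@[simp] theorem base_le (k : CopyTree N) : base ≤ k := trivial

@[simp] theorem fst_le_base {i : ℕ} : ¬ (fst i : CopyTree N) ≤ base := id

@[simp] theorem copy_le_base {i : ℕ} {j : ℤ} {t : N} : ¬ copy i j t ≤ base := id

@[simp] theorem fst_le_fst {i i' : ℕ} : (fst i : CopyTree N) ≤ fst i' ↔ i = i' := Iff.rfl

@[simp] theorem fst_le_copy {i i' : ℕ} {j : ℤ} {t : N} : fst i ≤ copy i' j t ↔ i = i' := Iff.rfl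

@[simp] theorem copy_le_fst {i i' : ℕ} {j : ℤ} {t : N} : ¬ copy i j t ≤ fst i' := id

@[simp] theorem copy_le_copy {i i' : ℕ} {j j' : ℤ} {s t : N} :
    copy i j s ≤ copy i' j' t ↔ i = i' ∧ j = j' ∧ s ≤ t := Iff.rfl

instance : PartialOrder (CopyTree N) where
  le_refl k := by rcases k with _ | i | ⟨i, j, t⟩ <;> simp
  le_trans k l m h₁ h₂ := by
    rcases k with _ | i | ⟨i, j, t⟩ <;> rcases l with _ | i' | ⟨i', j', t'⟩ <;>
      rcases m with _ | i'' | ⟨i'', j'', t''⟩ <;> simp at h₁ h₂ <;> simp [*]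
    exact h₁.2.2.trans h₂.2.2
  le_antisymm k l h₁ h₂ := by
    rcases k with _ | i | ⟨i, j, t⟩ <;> rcases l with _ | i' | ⟨i', j', t'⟩ <;>
      simp at h₁ h₂ <;> first | rfl | simp [h₁]
    exact h₁.2.2.antisymm h₂.2.2

@[simp] theorem base_lt_fst (i : ℕ) : (base : CopyTree N) < fst i := by simp [lt_iff_le_not_ge]

@[simp] theorem base_lt_copy (i : ℕ) (j : ℤ) (t : N) : base < copy i j t := by
  simp [lt_iff_le_not_ge]

@[simp] theorem not_lt_base (k : CopyTree N) : ¬ k < base := by simp [lt_iff_le_not_ge]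

@[simp] theorem not_fst_lt_fst (i i' : ℕ) : ¬ (fst i : CopyTree N) < fst i' := by
  simp +contextual [lt_iff_le_not_ge]

@[simp] theorem not_copy_lt_fst (i i' : ℕ) (j : ℤ) (t : N) : ¬ copy i j t < fst i' := by
  simp [lt_iff_le_not_ge]

@[simp] theorem fst_lt_copy {i i' : ℕ} {j : ℤ} {t : N} : fst i < copy i' j t ↔ i = i' := by
  simp [lt_iff_le_not_ge]

@[simp] theorem copy_lt_copy {i i' : ℕ} {j j' : ℤ} {s t : N} :
    copy i j s < copy i' j' t ↔ i = i' ∧ j = j' ∧ s < t := by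
  simp only [lt_iff_le_not_ge, copy_le_copy]
  constructor
  · rintro ⟨⟨rfl, rfl, h⟩, h'⟩
    exact ⟨rfl, rfl, h, fun h2 => h' ⟨rfl, rfl, h2⟩⟩
  · rintro ⟨rfl, rfl, h, h'⟩
    exact ⟨⟨rfl, rfl, h⟩, fun h2 => h' h2.2.2⟩

instance : OrderBot (CopyTree N) where
  bot := base
  bot_le := base_le

end

variable {N : Type} [PartialOrder N] [OrderBot N] [RoadTree N]

noncomputable def height : CopyTree N → ℝ
  | base => 0
  | fst _ => 1
  | copy _ _ t => 2 + ht t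

noncomputable def length : CopyTree N → ℝ
  | copy _ _ t => len t
  | _ => 1

/-- Copies over `fst i` are indexed by their direction, so shifting them is an integer shear of the
half plane of `fst i`. -/
def direction : CopyTree N → CopyTree N → ℤ
  | base, fst i => i
  | base, copy i _ _ => i
  | fst _, copy _ j _ => j
  | copy _ _ s, copy _ _ t => dir s t
  | _, _ => 0

noncomputable instance : RoadTree (CopyTree N) where
  ht := height
  len := length
  dir := direction
  le_or_le {k l m} h₁ h₂ := by
    rcases k with _ | i | ⟨i, j, t⟩ <;> rcases l with _ | i' | ⟨i', j', t'⟩ <;>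
      rcases m with _ | i'' | ⟨i'', j'', t''⟩ <;> simp_all
    exact le_or_le h₁.2.2 h₂.2.2
  len_pos k := by
    rcases k with _ | i | ⟨i, j, t⟩
    exacts [one_pos, one_pos, len_pos t]
  len_le_one k := by
    rcases k with _ | i | ⟨i, j, t⟩
    exacts [le_rfl, le_rfl, len_le_one t]
  ht_bot := rfl
  ht_add_len_le {k l} h := by
    rcases k with _ | i | ⟨i, j, t⟩ <;> rcases l with _ | i' | ⟨i', j', t'⟩ <;> simp at h <;>
      simp only [height, length]
    · norm_num
    · linarith [ht_nonneg t']
    · linarith [ht_nonneg t']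
    · linarith [ht_add_len_le h.2.2]
  exists_bound := by
    obtain ⟨b, hb⟩ := exists_bound (N := N)
    have hb0 : 0 < b := (top_pos (⊥ : N)).trans_le (hb ⊥)
    refine ⟨2 + b, fun k => ?_⟩
    rcases k with _ | i | ⟨i, j, t⟩ <;> simp only [height, length]
    · linarith
    · linarith
    · linarith [hb t]
  exists_lt_tile {h x} h0 hx := by
    rcases h with _ | i | ⟨i, j, t⟩ <;> simp only [height] at hx
    · exact absurd hx (not_lt.2 h0)
    · exact ⟨base, base_lt_fst i, h0, by simpa [height, length] using hx⟩
    · rcases lt_or_ge x 1 with h1 | h1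
      · exact ⟨base, base_lt_copy i j t, h0, by simpa [height, length] using h1⟩
      rcases lt_or_ge x 2 with h2 | h2
      · exact ⟨fst i, fst_lt_copy.2 rfl, h1, by simp only [height, length]; linarith⟩
      obtain ⟨k, hk, hk1, hk2⟩ := exists_lt_tile (h := t) (x := x - 2) (by linarith) (by linarith)
      exact ⟨copy i j k, copy_lt_copy.2 ⟨rfl, rfl, hk⟩, by simp only [height]; linarith,
        by simp only [height, length]; linarith⟩
  dir_self h := by
    rcases h with _ | i | ⟨i, j, t⟩
    exacts [rfl, rfl, dir_self t]
  dir_eq {k l m} h₁ h₂ := by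
    rcases k with _ | i | ⟨i, j, t⟩ <;> rcases l with _ | i' | ⟨i', j', t'⟩ <;>
      rcases m with _ | i'' | ⟨i'', j'', t''⟩ <;> simp at h₁ h₂ <;> simp [direction, *]
    exact dir_eq h₁.2.2 h₂.2.2
  exists_dir_ne {h h'} h₁ h₂ := by
    have hbase : ∀ {i i' : ℕ}, i ≠ i' → ((i : ℕ) : ℤ) ≠ i' := fun h => by exact_mod_cast h
    rcases h with _ | i | ⟨i, j, t⟩ <;> rcases h' with _ | i' | ⟨i', j', t'⟩ <;>
      simp only [base_le, not_true_eq_false, fst_le_fst, fst_le_copy, copy_le_fst, copy_le_copy]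
        at h₁ h₂
    · exact ⟨base, base_lt_fst i, base_lt_fst i', hbase h₁⟩
    · exact ⟨base, base_lt_fst i, base_lt_copy i' j' t', hbase h₁⟩
    · exact ⟨base, base_lt_copy i j t, base_lt_fst i', (hbase h₂).symm⟩
    · by_cases hi : i = i'
      · subst hi
        by_cases hj : j = j'
        · subst hj
          obtain ⟨k, hk, hk', hne⟩ := exists_dir_ne (h := t) (h' := t')
            (fun h => h₁ ⟨rfl, rfl, h⟩) (fun h => h₂ ⟨rfl, rfl, h⟩)
          exact ⟨copy i j k, copy_lt_copy.2 ⟨rfl, rfl, hk⟩, copy_lt_copy.2 ⟨rfl, rfl, hk'⟩, hne⟩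
        · exact ⟨fst i, fst_lt_copy.2 rfl, fst_lt_copy.2 rfl, hj⟩
      · exact ⟨base, base_lt_copy i j t, base_lt_copy i' j' t', hbase hi⟩

theorem ht_copy (i : ℕ) (j : ℤ) (t : N) : ht (copy i j t) = 2 + ht t := rfl

def translateFun (J : ℕ → ℤ) : CopyTree N → CopyTree N
  | copy i j t => copy i (j + J i) t
  | k => k

/-- The automorphism which replaces copy `j` over `fst i` by copy `j + J i`. -/
def translate (J : ℕ → ℤ) : Automorphism (CopyTree N) where
  toOrderIso :=
    { toFun := translateFun J
      invFun := translateFun fun i => -J i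
      left_inv := fun k => by rcases k with _ | i | ⟨i, j, t⟩ <;> simp [translateFun]
      right_inv := fun k => by rcases k with _ | i | ⟨i, j, t⟩ <;> simp [translateFun]
      map_rel_iff' := fun {k l} => by
        rcases k with _ | i | ⟨i, j, t⟩ <;> rcases l with _ | i' | ⟨i', j', t'⟩ <;>
          simp [translateFun]
        rintro rfl
        simp }
  shear
    | fst i => J i
    | _ => 0
  ht_eq k := by rcases k with _ | i | ⟨i, j, t⟩ <;> rfl
  len_eq k := by rcases k with _ | i | ⟨i, j, t⟩ <;> rfl
  dir_apply {k l} h := by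
    rcases k with _ | i | ⟨i, j, t⟩ <;> rcases l with _ | i' | ⟨i', j', t'⟩ <;> simp at h
    · exact (add_zero _).symm
    · exact (add_zero _).symm
    · subst h
      rfl
    · exact (add_zero _).symm

/-! ### Mapping classes of the surface over the tree of copies -/

variable (N) in
/-- The points of the surface below the second nodes of the copies of `N`. -/
def trunk : Set (RoadSurface (CopyTree N)) :=
  ⋃ p : ℕ × ℤ, {z | z.node ≤ copy p.1 p.2 ⊥}

theorem isOpen_trunk : IsOpen (trunk N) := isOpen_iUnion fun _ => RoadSurface.isOpen_source _

theorem isLindelof_trunk : IsLindelof (trunk N) :=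
  isLindelof_iUnion fun _ => RoadSurface.isLindelof_of_subset_source subset_rfl

/-- The strip of `copy p.1 p.2 ⊥` without its bottom line is included to make the set open. The
branches are then disjoint open sets covering the complement of the trunk. -/
def branch (p : ℕ × ℤ) : Set (RoadSurface (CopyTree N)) :=
  {z | copy p.1 p.2 ⊥ ≤ z.node ∧ ht (copy p.1 p.2 (⊥ : N)) < z.x}

theorem isOpen_branch (p : ℕ × ℤ) : IsOpen (branch (N := N) p) :=
  RoadSurface.isOpen_setOf_le_node _

theorem eq_of_mem_branch {p q : ℕ × ℤ} {z : RoadSurface (CopyTree N)} (hp : z ∈ branch p)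
    (hq : z ∈ branch q) : p = q := by
  have h1 := hp.1
  have h2 := hq.1
  rcases hz : z.node with _ | i | ⟨i, j, t⟩ <;> rw [hz] at h1 h2 <;> simp at h1 h2
  exact Prod.ext (h1.1.trans h2.1.symm) (h1.2.trans h2.2.symm)

theorem mem_branch_of_node_eq {i : ℕ} {j : ℤ} {t : N} (ht₀ : t ≠ ⊥)
    {z : RoadSurface (CopyTree N)} (hz : z.node = copy i j t) : z ∈ branch (i, j) := by
  refine ⟨by simp [hz], ?_⟩
  refine (ht_lt_ht ?_).trans_le z.ht_le
  rw [hz]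
  exact copy_lt_copy.2 ⟨rfl, rfl, bot_lt_iff_ne_bot.2 ht₀⟩

theorem exists_mem_branch {z : RoadSurface (CopyTree N)} (hz : z ∉ trunk N) :
    ∃ p, z ∈ branch p := by
  simp only [trunk, mem_iUnion, mem_ofPred_eq, not_exists] at hz
  rcases h : z.node with _ | i | ⟨i, j, t⟩
  · exact absurd (by simp [h]) (hz (0, 0))
  · exact absurd (by simp [h]) (hz (i, 0))
  · exact ⟨(i, j), mem_branch_of_node_eq (fun ht₀ => hz (i, j) (by simp [h, ht₀])) h⟩

theorem not_joinedIn_compl_trunk {p q : ℕ × ℤ} (hpq : p ≠ q)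
    {z z' : RoadSurface (CopyTree N)} (hz : z ∈ branch p) (hz' : z' ∈ branch q) :
    ¬ JoinedIn (trunk N)ᶜ z z' := by
  rintro ⟨γ, hγ⟩
  have hpre := (isPreconnected_univ (α := I)).image γ γ.continuous.continuousOn
  have ho : IsOpen (⋃ r ∈ {r | r ≠ p}, branch (N := N) r) :=
    isOpen_biUnion fun r _ => isOpen_branch r
  obtain ⟨y, -, hy1, hy2⟩ := hpre _ _ (isOpen_branch p) ho
    (by
      rintro _ ⟨t, -, rfl⟩
      obtain ⟨r, hr⟩ := exists_mem_branch (hγ t)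
      by_cases hrp : r = p
      · exact Or.inl (hrp ▸ hr)
      · exact Or.inr (mem_biUnion hrp hr))
    ⟨z, ⟨0, trivial, γ.source⟩, hz⟩
    ⟨z', ⟨1, trivial, γ.target⟩, mem_biUnion (show q ∈ {r | r ≠ p} from hpq.symm) hz'⟩
  obtain ⟨r, hr, hyr⟩ := mem_iUnion₂.1 hy2
  exact hr (eq_of_mem_branch hyr hy1)

/-- The point on the bottom edge of the strip over the node `copy i 0 t`. -/
noncomputable def bottomPoint (i : ℕ) (t : N) : RoadSurface (CopyTree N) where
  node := copy i 0 t
  x := ht (copy i 0 t)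
  w := 0
  x_pos := by
    rw [ht_copy]
    linarith [ht_nonneg t]
  ht_le := le_rfl
  lt_top := ht_lt_top _

theorem bottomPoint_injective (i : ℕ) : Function.Injective (bottomPoint (N := N) i) :=
  fun s t h => by
    have : (copy i 0 s : CopyTree N) = copy i 0 t := congrArg RoadSurface.node h
    cases this
    rfl

/-- The chart domain of k contains bottom points only of nodes below k, and L is covered by
countably many chart domains. -/
theorem countable_image_bottomPoint_inter (hN : ∀ t : N, (Iic t).Countable) (i : ℕ) (S : Set N)
    {L : Set (RoadSurface (CopyTree N))} (hL : IsLindelof L) :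
    (bottomPoint i '' S ∩ L).Countable := by
  obtain ⟨K, hK, h⟩ := hL.elim_countable_subcover _
    (fun k : CopyTree N => RoadSurface.isOpen_source k) fun z _ => mem_iUnion.2 ⟨z.node, le_refl z.node⟩
  have hc : ∀ k : CopyTree N, {t | copy i 0 t ≤ k}.Countable := fun k => by
    rcases k with _ | i' | ⟨i', j', t'⟩
    · simp
    · simp
    · exact (hN t').mono fun t ht => ht.2.2
  refine ((hK.biUnion fun k _ => hc k).image (bottomPoint i)).mono ?_
  rintro _ ⟨⟨t, -, rfl⟩, hz⟩
  obtain ⟨k, hk, hz⟩ := mem_iUnion₂.1 (h hz)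
  exact mem_image_of_mem _ (mem_biUnion hk hz)

theorem continuum_le_mk_mappingClassGroup (hN : ∀ t : N, (Iic t).Countable)
    (hN' : ¬ (univ : Set N).Countable) :
    Cardinal.continuum ≤ Cardinal.mk (MappingClassGroup (RoadSurface (CopyTree N))) := by
  refine _root_.continuum_le_mk_mappingClassGroup (ι := ℕ → ℤ) (by simp)
    (fun J => (translate J).homeomorph) fun J J' hJ => ?_
  by_contra hne
  obtain ⟨i, hi⟩ := Function.ne_iff.1 hne
  have h := Isotopic.mul (Isotopic.refl (translate J').homeomorph⁻¹) hJ
  rw [inv_mul_cancel] at h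
  have hcount := h.countable_of_not_joinedIn (Z := bottomPoint i '' {⊥}ᶜ) isOpen_trunk
    isLindelof_trunk (fun L => countable_image_bottomPoint_inter hN i _) (by
      rintro _ ⟨t, ht₀, rfl⟩
      -- The composite translation takes copy 0 over `fst i` to copy J i - J' i ≠ 0; the nodes t ≠ ⊥
      -- lie outside the trunk.
      refine not_joinedIn_compl_trunk (p := (i, 0 + J i - J' i)) (q := (i, 0)) (fun he => hi ?_)
        (mem_branch_of_node_eq ht₀ rfl) (mem_branch_of_node_eq ht₀ rfl)
      have := congrArg Prod.snd he
      simp only at this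
      linarith)
  have hc := countable_of_injective_of_countable_image (bottomPoint_injective i).injOn hcount
  exact hN' (((countable_singleton ⊥).union hc).mono fun t _ => em (t ∈ ({⊥} : Set N)))

/-- The level function on the tree of copies of `N` induced by a level function on `N`. -/
noncomputable def level (lvl : N → Ordinal.{0}) : CopyTree N → Ordinal.{0}
  | copy _ _ t => lvl t
  | _ => 0

theorem isTypeI {lvl : N → Ordinal.{0}} (hmono : ∀ j k, j ≤ k → lvl j ≤ lvl k)
    (hω : ∀ k, lvl k < Ordinal.omega 1)
    (hc : ∀ α < Ordinal.omega 1, {k | lvl k < α}.Countable)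
    (hlim : ∀ k α, (∀ j < k, lvl j < α) → lvl k ≤ α) : IsTypeI (RoadSurface (CopyTree N)) := by
  -- Only countably many nodes lie under the copies, so all of them can have level 0.
  refine RoadSurface.isTypeI (lvl := level lvl) (fun k l h => ?_) (fun k => ?_) (fun α hα => ?_)
    (fun k α h => ?_)
  · rcases k with _ | i | ⟨i, j, t⟩ <;> rcases l with _ | i' | ⟨i', j', t'⟩ <;> simp at h <;>
      simp only [level, le_refl, zero_le]
    exact hmono _ _ h.2.2
  · rcases k with _ | i | ⟨i, j, t⟩
    exacts [Ordinal.omega_pos 1, Ordinal.omega_pos 1, hω t]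
  · refine (((countable_singleton base).union (countable_range fst)).union
      (countable_iUnion fun p : ℕ × ℤ => (hc α hα).image (copy p.1 p.2))).mono fun k hk => ?_
    rcases k with _ | i | ⟨i, j, t⟩
    · exact Or.inl (Or.inl rfl)
    · exact Or.inl (Or.inr ⟨i, rfl⟩)
    · exact Or.inr (mem_iUnion.2 ⟨(i, j), t, hk, rfl⟩)
  · rcases k with _ | i | ⟨i, j, t⟩
    · exact zero_le
    · exact zero_le
    · exact hlim t α fun s hs => h (copy i j s) (copy_lt_copy.2 ⟨rfl, rfl, hs⟩)

end CopyTree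

theorem theorem7p4 :
    (ContractibleSpace PruferSurface ∧
      Cardinal.continuum ≤ Cardinal.mk (MappingClassGroup PruferSurface)) ∧
    (∃ (M : Type) (_ : TopologicalSpace M),
      IsSurface M ∧ IsTypeI M ∧ ContractibleSpace M ∧
      Cardinal.continuum ≤ Cardinal.mk (MappingClassGroup M)) :=
  ⟨⟨PruferSurface.contractibleSpace, PruferSurface.continuum_le_mk_mappingClassGroup⟩,
    RoadSurface (CopyTree AronszajnTree), inferInstance, RoadSurface.isSurface,
    CopyTree.isTypeI (fun _ _ => AronszajnTree.lvl_mono) AronszajnTree.lvl_lt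
      (fun _ => AronszajnTree.countable_setOf_lvl_lt)
      (fun _ _ => AronszajnTree.lvl_le_of_forall_lt),
    RoadSurface.contractibleSpace,
    CopyTree.continuum_le_mk_mappingClassGroup AronszajnTree.countable_Iic
      AronszajnTree.not_countable_univ⟩
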